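/- Let $F$ be a field of characteristic $0$, let $\mathcal Z=\langle z\rangle$ be infinite cyclic, $\mathcal Z_3=\langle a\rangle$ cyclic of order $3$, and $G=\mathcal Z\times\mathcal Z_3$. For any group $X$, a Schur ring over $X$ is a subspace $\mathcal A$ of $F[X]$ spanned by the elements $\overline C=\sum_{g\in C}g$, $C\in\mathcal D(\mathcal A)$, where $\mathcal D(\mathcal A)$ is a partition of $X$ into finite sets (the basic sets) such that $\{1\}\in\mathcal D(\mathcal A)$, $C^{-1}\in\mathcal D(\mathcal A)$ for every $C\in\mathcal D(\mathcal A)$, and $\overline C\cdot\overline E\in\mathcal A$ for all $C,E\in\mathcal D(\mathcal A)$. A subgroup that is a union of basic sets is called an $S$-subgroup. For a finite group $\mathcal K$ of automorphisms of $X$, the orbit Schur ring $F[X]^{\mathcal K}$ is the set of elements of $F[X]$ fixed by $\mathcal K$; $F[X]$ is the discrete Schur ring; for abelian $X$, $F[X]^{\pm}$ is the orbit Schur ring of the group generated by $g\mapsto g^{-1}$. $\mathcal A$ is a wedge product if there are $S$-subgroups $1<K\le H<X$ with $K$ normal in $X$ such that every basic set outside $H$ is a union of $K$-cosets. In that case we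 write $\mathcal A=\mathcal A_1\wedge\mathcal A_2$, where $\mathcal A_1=\mathcal A_H$ is the Schur ring over $H$ whose basic sets are those of $\mathcal A$ contained in $H$, and $\mathcal A_2=\mathcal A_{X/K}$ is the Schur ring over $X/K$ whose basic sets are the images of those of $\mathcal A$. $\mathcal A$ is traditional if it is the trivial Schur ring (with $X$ finite and basic sets $\{1\}$ and, if nonempty, $X\setminus\{1\}$), an orbit Schur ring, a tensor product of Schur rings over two proper subgroups $H,K$ with $X=H\times K$ (basic sets $CE$, with $C$ and $E$ basic sets of the factors), or a wedge product. A group is traditional if all Schur rings over it are. **Theorem.** Every Schur ring $\mathcal A$ over $G$ has one of the following forms, where in (i)–(iii) the wedge product is taken with normal $S$-subgroup $\mathcal Z_3$, and $G/\mathcal Z_3$ is identified with $\mathcal Z$: (i) $\mathcal A_1\wedge F[\mathcal Z]$ or $\mathcal A_1\wedge F[\mathcal Z]^{\pm}$ with $\mathcal A_1\in\{F[\mathcal Z_3],\,F[\mathcal Z_3]^{\pm}\}$; (ii) for some $1<H=\langle h\rangle<\mathcal Z$: $\mathcal A_1\wedge F[\mathcal Z]$ with $\mathcal A_1\in\{F[H\times\mathcal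 Z_3],\ F[H\times\mathcal Z_3]^{\langle\alpha\rangle}\}$, or $\mathcal A_1\wedge F[\mathcal Z]^{\pm}$ with $\mathcal A_1\in\{F[H\times\mathcal Z_3]^{\pm},\ F[H\times\mathcal Z_3]^{\langle\beta\rangle},\ F[H\times\mathcal Z_3]^{\langle\alpha,\beta\rangle}\}$, where $\alpha,\beta$ are the automorphisms of $H\times\mathcal Z_3$ with $\alpha:h\mapsto h,\ a\mapsto a^2$ and $\beta:h\mapsto h^{-1},\ a\mapsto a$; (iii) for some $1<K=\langle k\rangle<\mathcal Z$ and some $c\in\{a,a^2\}$: $F[K\times\mathcal Z_3]^{\langle\psi\rangle}\wedge F[\mathcal Z]$, or $\mathcal A_1\wedge F[\mathcal Z]^{\pm}$ with $\mathcal A_1\in\{F[K\times\mathcal Z_3]^{\langle\rho\rangle},\ F[K\times\mathcal Z_3]^{\langle\psi,\xi\rangle}\}$, where $\psi,\rho,\xi$ are the automorphisms of $K\times\mathcal Z_3$ with $\psi:k\mapsto ck,\ a\mapsto a^2$; $\rho:k\mapsto ck^{-1},\ a\mapsto a$; and $\xi:k\mapsto k^{-1},\ a\mapsto a^2$; (iv)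 $F[\mathcal Z\times\mathcal Z_3]$ or $F[\mathcal Z\times\mathcal Z_3]^{\pm}$; (v) an orbit Schur ring $F[G]^{\mathcal K}$ for some finite group $\mathcal K$ of automorphisms of $G$. Hence every Schur ring over $\mathcal Z\times\mathcal Z_3$ is an orbit Schur ring or a wedge product, and the group $\mathcal Z\times\mathcal Z_3$ is traditional. -/

import Mathlib

open scoped Pointwise

noncomputable section

/-- The simple quantity of a finite set `C` of group elements: the sum of its elements in the
group algebra `F[G]`. -/
def simpleQuantity (F : Type*) [Field F] {G : Type*} (C : Set G) : MonoidAlgebra F G :=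
  ∑ᶠ g ∈ C, MonoidAlgebra.single g (1 : F)

/-- A Schur ring over `G` with coefficients in `F`, given by its partition `D` of `G` into finite
basic sets. The Schur ring itself, as a subspace of `F[G]`, is `SchurRing.carrier`. -/
structure SchurRing (F : Type*) [Field F] (G : Type*) [Group G] where
  /-- the set of basic sets -/
  D : Set (Set G)
  isPartition : Setoid.IsPartition D
  finite_of_mem : ∀ C ∈ D, C.Finite
  one_mem : {1} ∈ D
  inv_mem : ∀ C ∈ D, C⁻¹ ∈ D
  mul_mem : ∀ C ∈ D, ∀ E ∈ D,
    simpleQuantity F C * simpleQuantity F E ∈ Submodule.span F (simpleQuantity F '' D)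

/-- The elements of `F[G]` fixed by a group `𝒦` of automorphisms of `G`. -/
def fixedElements (F : Type*) [Field F] {G : Type*} [Group G] (𝒦 : Subgroup (MulAut G)) :
    Submodule F (MonoidAlgebra F G) where
  carrier := {x | ∀ φ ∈ 𝒦, MonoidAlgebra.domCongr F F φ x = x}
  add_mem' := by
    intro x y hx hy φ hφ
    rw [map_add, hx φ hφ, hy φ hφ]
  zero_mem' := fun φ _ => map_zero _
  smul_mem' := by
    intro c x hx φ hφ
    rw [map_smul, hx φ hφ]

namespace SchurRing

variable {F : Type*} [Field F]

/-- The subspace of `F[G]` spanned by the simple quantities of the basic sets. -/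
def carrier {G : Type*} [Group G] (A : SchurRing F G) : Submodule F (MonoidAlgebra F G) :=
  Submodule.span F (simpleQuantity F '' A.D)

/-- `A = F[G]`, the discrete Schur ring. -/
def IsDiscrete {G : Type*} [Group G] (A : SchurRing F G) : Prop := A.carrier = ⊤

/-- `A = F[G]^𝒦`, the orbit Schur ring of a finite group `𝒦` of automorphisms of `G`. -/
def IsOrbit {G : Type*} [Group G] (A : SchurRing F G) (𝒦 : Subgroup (MulAut G)) : Prop :=
  Finite 𝒦 ∧ A.carrier = fixedElements F 𝒦

/-- `A = F[G]^±`, the symmetric Schur ring over an abelian group `G`: the elements of `F[G]` fixed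
by `g ↦ g⁻¹`. -/
def IsSymmetric {G : Type*} [CommGroup G] (A : SchurRing F G) : Prop :=
  A.IsOrbit (Subgroup.zpowers (MulEquiv.inv G))

/-- `A` is the trivial Schur ring over the finite group `G`, with basic sets `{1}` and `G \ {1}`
(the latter only if it is nonempty). -/
def IsTrivial {G : Type*} [Group G] (A : SchurRing F G) : Prop :=
  Finite G ∧ ∀ C : Set G, C ∈ A.D ↔ C = {1} ∨ (C = {1}ᶜ ∧ C.Nonempty)

/-- `A` is an orbit Schur ring. -/
def IsOrbitSchurRing {G : Type*} [Group G] (A : SchurRing F G) : Prop :=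
  ∃ 𝒦 : Subgroup (MulAut G), A.IsOrbit 𝒦

/-- `G` is the internal direct product of proper subgroups `H` and `K`, and `A` is the tensor
product of Schur rings over `H` and over `K`. -/
def IsTensorProduct {G : Type*} [Group G] (A : SchurRing F G) : Prop :=
  ∃ H K : Subgroup G, H ≠ ⊤ ∧ K ≠ ⊤ ∧ H.IsComplement' K ∧ (∀ h ∈ H, ∀ k ∈ K, Commute h k) ∧
    ∃ (B : SchurRing F H) (C : SchurRing F K),
      A.D = {X | ∃ Y ∈ B.D, ∃ Z ∈ C.D, X = (Subtype.val '' Y) * (Subtype.val '' Z)}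

/-- `H` is an `S`-subgroup of `A`: a subgroup that is a union of basic sets. -/
def IsSSubgroup {G : Type*} [Group G] (A : SchurRing F G) (H : Subgroup G) : Prop :=
  ∃ T ⊆ A.D, (H : Set G) = ⋃₀ T

/-- `1 < K ≤ H < G` is a wedge-decomposition of `A`: `H` and `K` are `S`-subgroups, `K` is normal
in `G`, and every basic set outside `H` is a union of `K`-cosets. -/
def IsWedgeDecomposition {G : Type*} [Group G] (A : SchurRing F G) (K H : Subgroup G) : Prop :=
  K ≠ ⊥ ∧ K ≤ H ∧ H ≠ ⊤ ∧ K.Normal ∧ A.IsSSubgroup K ∧ A.IsSSubgroup H ∧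
    ∀ C ∈ A.D, Disjoint C (H : Set G) → C * (K : Set G) = C

/-- `A` is a wedge product. -/
def IsWedgeProduct {G : Type*} [Group G] (A : SchurRing F G) : Prop :=
  ∃ K H : Subgroup G, A.IsWedgeDecomposition K H

/-- `A = A₁ ∧ A₂` with respect to the wedge-decomposition `1 < K ≤ H < G`, where
`A₁ = A_H` is the Schur ring over `H` whose basic sets are those of `A` contained in `H`, and
`A₂ = A_{G/K}` is the Schur ring over `G ⧸ K` whose basic sets are the images of those of `A`. -/
def IsWedge {G : Type*} [Group G] (A : SchurRing F G) (K H : Subgroup G) [K.Normal]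
    (A₁ : SchurRing F H) (A₂ : SchurRing F (G ⧸ K)) : Prop :=
  A.IsWedgeDecomposition K H ∧
    (∀ C : Set H, C ∈ A₁.D ↔ (Subtype.val '' C : Set G) ∈ A.D) ∧
    A₂.D = (fun C : Set G => (QuotientGroup.mk '' C : Set (G ⧸ K))) '' A.D

/-- `A` is traditional: trivial, an orbit Schur ring, a tensor product, or a wedge product. -/
def IsTraditional {G : Type*} [Group G] (A : SchurRing F G) : Prop :=
  A.IsTrivial ∨ A.IsOrbitSchurRing ∨ A.IsTensorProduct ∨ A.IsWedgeProduct

end SchurRing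

/-- The group `G` is traditional: every Schur ring over it is traditional. -/
def IsTraditionalGroup (F : Type*) [Field F] (G : Type*) [Group G] : Prop :=
  ∀ A : SchurRing F G, A.IsTraditional

/-- The infinite cyclic group, written multiplicatively. -/
abbrev Z : Type := Multiplicative ℤ

/-- The cyclic group of order three, written multiplicatively. -/
abbrev Z3 : Type := Multiplicative (ZMod 3)

/-- The generator of the cyclic group of order three. -/
def genA : Z3 := Multiplicative.ofAdd 1

/-- The subgroup `H × Z₃` of `Z × Z₃`. -/
abbrev timesZ3 (H : Subgroup Z) : Subgroup (Z × Z3) := H.prod ⊤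

/-- The subgroup `Z₃` of `Z × Z₃`. -/
abbrev subZ3 : Subgroup (Z × Z3) := timesZ3 ⊥

/-- For `H = ⟨h⟩`, the automorphism `φ` of `H × Z₃` is the one with `h ↦ x` and `a ↦ y`. -/
def IsAutWith (H : Subgroup Z) (φ : MulAut (timesZ3 H)) (h : Z) (x : Z × Z3) (y : Z3) : Prop :=
  H = Subgroup.zpowers h ∧
    (∀ u : timesZ3 H, (u : Z × Z3) = (h, 1) → (φ u : Z × Z3) = x) ∧
    ∀ u : timesZ3 H, (u : Z × Z3) = (1, genA) → (φ u : Z × Z3) = (1, y)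

end

/-! Everything rests on the torsion subgroup `Z₃` being an `S`-subgroup of every Schur ring. Modulo
a prime `p` the Frobenius sends the sum of an `S`-set to the sum of its `p`-th powers, so an
injective `p`-th power map preserves finite `S`-sets (`IsSSet.image_pow_prime`). Squaring inverts
`Z₃` and doubles first coordinates, and a descent then traps the basic sets of torsion elements
inside `Z₃` (`fst_eq_one_of_mem_block`). Hence the Schur ring has a quotient over `Z`, and power
maps show that this is the group ring or the symmetric Schur ring (`block_of_infinite_cyclic`).

A `Z₃`-coset that is not contained in one basic set has a point that is the only one of its basic
set in that coset, because three points split into several parts leave a singleton part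
(`exists_isTransversal`). If the quotient is discrete, such a point is a basic set by itself. If it
is symmetric and the coset is not `Z₃`, the coset contains a point `x` with basic set `{x, x⁻¹}`
(`exists_isSymmPair`). In either case the first coordinates of the special points form a subgroup
`⟨h⟩` of `Z`. Cosets over the complement of `⟨h⟩` lie in single basic sets, which is the wedge
condition; over `⟨h⟩` the basic sets are computed from a special point `x = (h, d)` and the basic
sets in `Z₃` (`structure_of_quotient_discrete`, `structure_of_quotient_symmetric`).

The change of coordinates `z ↦ x`, `a ↦ a` (`shear`) turns the non-discrete answers into orbits of
inversions of the two factors. The classification reads off `h`: trivial, a generator of `Z`, or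
neither; in the last case `d` separates the straight automorphisms from the twisted ones. -/

noncomputable section

/-! ### Coefficients of simple quantities -/

section simpleQuantity

variable {F : Type*} [Field F] {G : Type*}

open scoped Classical in
theorem coeff_simpleQuantity {C : Set G} (hC : C.Finite) (g : G) :
    (simpleQuantity F C).coeff g = if g ∈ C then 1 else 0 := by
  rw [simpleQuantity, finsum_mem_eq_finite_toFinset_sum _ hC, MonoidAlgebra.coeff_sum,
    Finsupp.finsetSum_apply]
  simp [Finsupp.single_apply]

/-- This reduces every span condition to comparing coefficients. For the converse direction,
subtracting the right multiple of one part clears it from the support, which is finite. -/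
theorem mem_span_simpleQuantity_iff {D : Set (Set G)} (hD : Setoid.IsPartition D)
    (hfin : ∀ C ∈ D, C.Finite) (x : MonoidAlgebra F G) :
    x ∈ Submodule.span F (simpleQuantity F '' D) ↔
      ∀ C ∈ D, ∀ g ∈ C, ∀ h ∈ C, x.coeff g = x.coeff h := by
  classical
  constructor
  · intro hx C hC g hg h hh
    induction hx using Submodule.span_induction with
    | mem y hy =>
      obtain ⟨E, hE, rfl⟩ := hy
      have key : g ∈ E ↔ h ∈ E := by
        constructor
        · intro hgE
          rwa [(hD.2 g).unique ⟨hE, hgE⟩ ⟨hC, hg⟩]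
        · intro hhE
          rwa [(hD.2 h).unique ⟨hE, hhE⟩ ⟨hC, hh⟩]
      rw [coeff_simpleQuantity (hfin E hE), coeff_simpleQuantity (hfin E hE)]
      simp only [key]
    | zero => simp
    | add y z _ _ hy hz => simp [hy, hz]
    | smul c y _ hy => simp [hy]
  · intro hx
    induction hn : x.coeff.support.card using Nat.strong_induction_on generalizing x with
    | _ n ih =>
      by_cases h0 : x = 0
      · rw [h0]; exact Submodule.zero_mem _
      obtain ⟨g, hg⟩ : ∃ g, x.coeff g ≠ 0 := by
        by_contra! h
        exact h0 (MonoidAlgebra.coeff_injective (Finsupp.ext h))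
      obtain ⟨C, ⟨hC, hgC⟩, -⟩ := hD.2 g
      have hmem : x.coeff g • simpleQuantity F C ∈ Submodule.span F (simpleQuantity F '' D) :=
        Submodule.smul_mem _ _ (Submodule.subset_span ⟨C, hC, rfl⟩)
      have hcoeff : ∀ u, (x - x.coeff g • simpleQuantity F C).coeff u =
          if u ∈ C then 0 else x.coeff u := by
        intro u
        rw [MonoidAlgebra.coeff_sub, Finsupp.sub_apply, MonoidAlgebra.coeff_smul_apply,
          coeff_simpleQuantity (hfin C hC)]
        split_ifs with hu
        · simp [hx C hC u hu g hgC]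
        · simp
      have := ih (x - x.coeff g • simpleQuantity F C).coeff.support.card ?_ _ ?_ rfl
      · simpa using Submodule.add_mem _ this hmem
      · rw [← hn]
        apply Finset.card_lt_card
        refine Finset.ssubset_iff_subset_ne.2 ⟨fun u hu => ?_, fun h => ?_⟩
        · rw [Finsupp.mem_support_iff, hcoeff] at hu
          rw [Finsupp.mem_support_iff]
          split_ifs at hu with h
          · exact absurd rfl hu
          · exact hu
        · have : g ∈ (x - x.coeff g • simpleQuantity F C).coeff.support := by
            rw [h]; exact Finsupp.mem_support_iff.2 hg
          rw [Finsupp.mem_support_iff, hcoeff, if_pos hgC] at this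
          exact this rfl
      · intro E hE u hu v hv
        rw [hcoeff, hcoeff, hx E hE u hu v hv]
        have key : u ∈ C ↔ v ∈ C := by
          constructor
          · intro h
            rwa [(hD.2 u).unique ⟨hC, h⟩ ⟨hE, hu⟩]
          · intro h
            rwa [(hD.2 v).unique ⟨hC, h⟩ ⟨hE, hv⟩]
        simp only [key]

/-- The structure constants are cardinalities. This permits comparing them as integers in
characteristic zero and moving them to another field. -/
theorem coeff_simpleQuantity_mul [Group G] {C E : Set G} (hC : C.Finite) (hE : E.Finite) (g : G) :
    (simpleQuantity F C * simpleQuantity F E).coeff g =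
      ({c ∈ C | c⁻¹ * g ∈ E}.ncard : F) := by
  classical
  have h1 : simpleQuantity F C = ∑ c ∈ hC.toFinset, MonoidAlgebra.single c (1 : F) :=
    finsum_mem_eq_finite_toFinset_sum _ hC
  rw [h1, Finset.sum_mul, MonoidAlgebra.coeff_sum, Finsupp.finsetSum_apply]
  simp only [MonoidAlgebra.coeff_single_mul_apply, one_mul, coeff_simpleQuantity hE]
  rw [Finset.sum_boole, ← Set.ncard_coe_finset]
  congr 2
  ext c
  simp

theorem mapDomain_simpleQuantity {Q : Type*} {f : G → Q} (hf : Function.Injective f)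
    {C : Set G} (hC : C.Finite) :
    MonoidAlgebra.mapDomain f (simpleQuantity F C) = simpleQuantity F (f '' C) := by
  classical
  rw [simpleQuantity, simpleQuantity, finsum_mem_eq_finite_toFinset_sum _ hC,
    finsum_mem_eq_finite_toFinset_sum _ (hC.image f)]
  have : (hC.image f).toFinset = hC.toFinset.image f := by ext; simp
  rw [this, Finset.sum_image (fun _ _ _ _ h => hf h)]
  induction hC.toFinset using Finset.induction_on with
  | empty => simp
  | insert a s ha ih => rw [Finset.sum_insert ha, Finset.sum_insert ha, MonoidAlgebra.mapDomain_add,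
      ih, MonoidAlgebra.mapDomain_single]

end simpleQuantity

theorem mem_fixedElements_iff {F : Type*} [Field F] {G : Type*} [Group G]
    {𝒦 : Subgroup (MulAut G)} {x : MonoidAlgebra F G} :
    x ∈ fixedElements F 𝒦 ↔ ∀ φ ∈ 𝒦, ∀ g, x.coeff (φ g) = x.coeff g := by
  constructor
  · intro h φ hφ g
    have := congrArg (fun y => MonoidAlgebra.coeff y (φ g)) (h φ hφ)
    simpa using this.symm
  · intro h φ hφ
    apply MonoidAlgebra.coeff_injective
    ext g
    have := h φ hφ (φ.symm g)
    rw [MonoidAlgebra.coeff_domCongr, ← this]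
    simp

/-! ### Basic sets, `S`-sets and power maps in an arbitrary Schur ring -/

namespace SchurRing

variable {F : Type*} [Field F] {G : Type*} [Group G] (A : SchurRing F G)

/-- The basic set containing `g`. -/
def block (g : G) : Set G := (A.isPartition.2 g).choose

theorem block_mem_D (g : G) : A.block g ∈ A.D := (A.isPartition.2 g).choose_spec.1.1

theorem mem_block (g : G) : g ∈ A.block g := (A.isPartition.2 g).choose_spec.1.2

variable {A} in
theorem eq_block {C : Set G} (hC : C ∈ A.D) {g : G} (hg : g ∈ C) : C = A.block g :=
  (A.isPartition.2 g).unique ⟨hC, hg⟩ ⟨A.block_mem_D g, A.mem_block g⟩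

variable {A} in
theorem block_eq {g h : G} (hh : h ∈ A.block g) : A.block h = A.block g :=
  (eq_block (A.block_mem_D g) hh).symm

variable {A} in
theorem mem_block_symm {g h : G} (hh : h ∈ A.block g) : g ∈ A.block h :=
  block_eq hh ▸ A.mem_block g

theorem finite_block (g : G) : (A.block g).Finite := A.finite_of_mem _ (A.block_mem_D g)

theorem mem_D_iff {C : Set G} : C ∈ A.D ↔ ∃ g, C = A.block g := by
  constructor
  · intro hC
    obtain ⟨g, hg⟩ := Setoid.nonempty_of_mem_partition A.isPartition hC
    exact ⟨g, eq_block hC hg⟩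
  · rintro ⟨g, rfl⟩
    exact A.block_mem_D g

@[simp]
theorem block_one : A.block 1 = {1} := (eq_block A.one_mem rfl).symm

theorem block_inv (g : G) : A.block g⁻¹ = (A.block g)⁻¹ :=
  (eq_block (A.inv_mem _ (A.block_mem_D g)) (by simpa using A.mem_block g)).symm

theorem mem_carrier_iff {x : MonoidAlgebra F G} :
    x ∈ A.carrier ↔ ∀ g, ∀ h ∈ A.block g, x.coeff h = x.coeff g := by
  rw [carrier, mem_span_simpleQuantity_iff A.isPartition A.finite_of_mem]
  constructor
  · intro hx g h hh
    exact hx _ (A.block_mem_D g) h hh g (A.mem_block g)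
  · intro hx C hC g hg h hh
    rw [eq_block hC hg] at hh
    exact (hx g h hh).symm

theorem mul_mem_carrier {x y : MonoidAlgebra F G} (hx : x ∈ A.carrier) (hy : y ∈ A.carrier) :
    x * y ∈ A.carrier := by
  refine Submodule.span_induction₂ (p := fun x y _ _ => x * y ∈ A.carrier) ?_ ?_ ?_ ?_ ?_ ?_ ?_
    hx hy
  · rintro _ _ ⟨C, hC, rfl⟩ ⟨E, hE, rfl⟩
    exact A.mul_mem C hC E hE
  · intro y _; simp
  · intro x _; simp
  · intro x y z _ _ _ h1 h2; rw [add_mul]; exact Submodule.add_mem _ h1 h2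
  · intro x y z _ _ _ h1 h2; rw [mul_add]; exact Submodule.add_mem _ h1 h2
  · intro r x y _ _ h; rw [smul_mul_assoc]; exact Submodule.smul_mem _ _ h
  · intro r x y _ _ h; rw [mul_smul_comm]; exact Submodule.smul_mem _ _ h

theorem one_mem_carrier : (1 : MonoidAlgebra F G) ∈ A.carrier := by
  have : simpleQuantity F {(1 : G)} = 1 := by simp [simpleQuantity, MonoidAlgebra.one_def]
  rw [← this]
  exact Submodule.subset_span ⟨_, A.one_mem, rfl⟩

theorem pow_mem_carrier {x : MonoidAlgebra F G} (hx : x ∈ A.carrier) (n : ℕ) :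
    x ^ n ∈ A.carrier := by
  induction n with
  | zero => simpa using A.one_mem_carrier
  | succ n ih => rw [pow_succ]; exact A.mul_mem_carrier ih hx

/-- A set is an `S`-set if it is a union of basic sets. -/
def IsSSet (S : Set G) : Prop := ∀ g ∈ S, A.block g ⊆ S

variable {A}

theorem isSSet_block (g : G) : A.IsSSet (A.block g) := fun _ hh => (block_eq hh).subset

theorem isSSet_of_mem_D {C : Set G} (hC : C ∈ A.D) : A.IsSSet C := by
  obtain ⟨g, rfl⟩ := A.mem_D_iff.1 hC
  exact isSSet_block g

theorem isSSet_one : A.IsSSet {1} := by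
  rw [← A.block_one]
  exact isSSet_block 1

theorem IsSSet.mem_iff {S : Set G} (hS : A.IsSSet S) {g h : G} (hh : h ∈ A.block g) :
    h ∈ S ↔ g ∈ S :=
  ⟨fun h' => hS h h' (mem_block_symm hh), fun h' => hS g h' hh⟩

theorem IsSSet.compl {S : Set G} (hS : A.IsSSet S) : A.IsSSet Sᶜ :=
  fun _ hg _ hh h' => hg ((hS.mem_iff hh).1 h')

theorem IsSSet.inter {S T : Set G} (hS : A.IsSSet S) (hT : A.IsSSet T) : A.IsSSet (S ∩ T) :=
  fun g hg _ hh => ⟨hS g hg.1 hh, hT g hg.2 hh⟩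

theorem IsSSet.diff {S T : Set G} (hS : A.IsSSet S) (hT : A.IsSSet T) : A.IsSSet (S \ T) :=
  hS.inter hT.compl

theorem IsSSet.isSSubgroup {H : Subgroup G} (hH : A.IsSSet (H : Set G)) : A.IsSSubgroup H := by
  refine ⟨{C | C ∈ A.D ∧ C ⊆ H}, fun C hC => hC.1, ?_⟩
  ext g
  constructor
  · intro hg
    exact ⟨A.block g, ⟨A.block_mem_D g, hH g hg⟩, A.mem_block g⟩
  · rintro ⟨C, ⟨-, hC⟩, hg⟩
    exact hC hg

theorem isSSet_iff_simpleQuantity {S : Set G} (hS : S.Finite) :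
    A.IsSSet S ↔ simpleQuantity F S ∈ A.carrier := by
  classical
  rw [mem_carrier_iff]
  simp only [coeff_simpleQuantity hS]
  constructor
  · intro h g u hu
    simp only [h.mem_iff hu]
  · intro h g hg u hu
    have := h g u hu
    rw [if_pos hg] at this
    by_contra hn
    simp [hn] at this

theorem isDiscrete_of_block (h : ∀ g, ∀ u ∈ A.block g, u = g) : A.IsDiscrete := by
  rw [IsDiscrete, eq_top_iff]
  intro x _
  rw [mem_carrier_iff]
  intro g u hu
  rw [h g u hu]

theorem isOrbit_of_block {𝒦 : Subgroup (MulAut G)} [Finite 𝒦]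
    (h1 : ∀ φ ∈ 𝒦, ∀ g, φ g ∈ A.block g) (h2 : ∀ g, ∀ u ∈ A.block g, ∃ φ ∈ 𝒦, φ g = u) :
    A.IsOrbit 𝒦 := by
  refine ⟨inferInstance, ?_⟩
  ext x
  rw [mem_carrier_iff, mem_fixedElements_iff]
  constructor
  · intro h φ hφ g
    exact h g _ (h1 φ hφ g)
  · intro h g u hu
    obtain ⟨φ, hφ, rfl⟩ := h2 g u hu
    exact h φ hφ g

/-- Finiteness of the group comes for free: an automorphism is determined by its values on finitely
many generators, and each value stays in the finite basic set of that generator. -/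
theorem isOrbit_closure [Group.FG G] {S : Set (MulAut G)} (h1 : ∀ φ ∈ S, ∀ g, φ g ∈ A.block g)
    (h2 : ∀ g, ∀ u ∈ A.block g, ∃ φ ∈ Subgroup.closure S, φ g = u) :
    A.IsOrbit (Subgroup.closure S) := by
  have h1' : ∀ φ ∈ Subgroup.closure S, ∀ g, φ g ∈ A.block g := by
    intro φ hφ
    induction hφ using Subgroup.closure_induction with
    | mem φ hφ => exact h1 φ hφ
    | one => exact fun g => A.mem_block g
    | mul φ ψ _ _ ihφ ihψ =>
      intro g
      rw [← block_eq (ihψ g)]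
      exact ihφ (ψ g)
    | inv φ _ ih =>
      intro g
      have := mem_block_symm (ih (φ⁻¹ g))
      rwa [MulAut.apply_inv_self] at this
  have : Finite (Subgroup.closure S) := by
    obtain ⟨T, hT⟩ := Group.FG.out (G := G)
    have hf : ∀ t : T, Finite (A.block t) := fun t => A.finite_block t
    refine Finite.of_injective
      (fun (φ : Subgroup.closure S) (t : T) => (⟨φ.1 t, h1' φ.1 φ.2 t⟩ : A.block t)) ?_
    intro φ ψ hφψ
    apply Subtype.ext
    apply MulEquiv.toMonoidHom_injective
    refine MonoidHom.eq_of_eqOn_dense hT fun t ht => ?_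
    exact congrArg Subtype.val (congrFun hφψ ⟨t, ht⟩)
  exact isOrbit_of_block h1' h2

theorem IsDiscrete.isOrbitSchurRing (h : A.IsDiscrete) : A.IsOrbitSchurRing := by
  refine ⟨⊥, inferInstance, ?_⟩
  rw [h, eq_comm, eq_top_iff]
  intro x _
  rw [mem_fixedElements_iff]
  intro φ hφ g
  rw [Subgroup.mem_bot.1 hφ]
  rfl

theorem isSymmetric_of_block {G : Type*} [CommGroup G] {A : SchurRing F G}
    (h : ∀ g u, u ∈ A.block g ↔ u = g ∨ u = g⁻¹) : A.IsSymmetric := by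
  have hsq : (MulEquiv.inv G : MulAut G) ^ 2 = 1 := by ext g; simp [pow_two]
  have : Finite (Subgroup.zpowers (MulEquiv.inv G : MulAut G)) :=
    (isOfFinOrder_iff_pow_eq_one.2 ⟨2, by norm_num, hsq⟩).finite_zpowers
  refine isOrbit_of_block ?_ ?_
  · rintro _ ⟨n, rfl⟩ g
    rw [h]
    rcases Int.even_or_odd' n with ⟨k, rfl | rfl⟩
    · left
      simp only [zpow_mul]
      rw [show (MulEquiv.inv G : MulAut G) ^ (2 : ℤ) = 1 from mod_cast hsq]
      simp
    · right
      simp only [zpow_add, zpow_mul]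
      rw [show (MulEquiv.inv G : MulAut G) ^ (2 : ℤ) = 1 from mod_cast hsq]
      simp
  · intro g u hu
    rcases (h g u).1 hu with rfl | rfl
    · exact ⟨1, Subgroup.one_mem _, rfl⟩
    · exact ⟨_, Subgroup.mem_zpowers _, rfl⟩

section charZero

variable [CharZero F]

theorem ncard_eq_of_mem_block {S T : Set G} (hS : A.IsSSet S) (hT : A.IsSSet T) (hSf : S.Finite)
    (hTf : T.Finite) {g h : G} (hh : h ∈ A.block g) :
    {c ∈ S | c⁻¹ * h ∈ T}.ncard = {c ∈ S | c⁻¹ * g ∈ T}.ncard := by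
  have := A.mem_carrier_iff.1 (A.mul_mem_carrier ((isSSet_iff_simpleQuantity hSf).1 hS)
    ((isSSet_iff_simpleQuantity hTf).1 hT)) g h hh
  rw [coeff_simpleQuantity_mul hSf hTf, coeff_simpleQuantity_mul hSf hTf] at this
  exact_mod_cast this

/-- The number of factorisations of an element is constant on basic sets as an integer, so it is
nonzero on all of a basic set or on none of it. -/
theorem IsSSet.mul {S T : Set G} (hS : A.IsSSet S) (hT : A.IsSSet T) : A.IsSSet (S * T) := by
  rintro _ ⟨s, hs, t, ht, rfl⟩ h hh
  have key := ncard_eq_of_mem_block (isSSet_block s) (isSSet_block t) (A.finite_block s)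
    (A.finite_block t) hh
  have h1 : {c ∈ A.block s | c⁻¹ * (s * t) ∈ A.block t}.ncard ≠ 0 :=
    Set.ncard_ne_zero_of_mem (a := s) ⟨A.mem_block s, by simpa using A.mem_block t⟩
      ((A.finite_block s).subset fun _ h => h.1)
  simp only at key h1
  rw [← key] at h1
  obtain ⟨c, hc, hc'⟩ := Set.nonempty_of_ncard_ne_zero h1
  exact ⟨c, hS s hs hc, c⁻¹ * h, hT t ht hc', by simp⟩

variable (A) in
/-- The Schur ring with the same basic sets over another field. -/
def changeField (K : Type*) [Field K] : SchurRing K G where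
  D := A.D
  isPartition := A.isPartition
  finite_of_mem := A.finite_of_mem
  one_mem := A.one_mem
  inv_mem := A.inv_mem
  mul_mem := by
    intro C hC E hE
    rw [mem_span_simpleQuantity_iff A.isPartition A.finite_of_mem]
    intro B hB g hg h hh
    have hCf := A.finite_of_mem C hC
    have hEf := A.finite_of_mem E hE
    -- The counts agree as natural numbers over `F`, hence their casts agree in any field.
    rw [coeff_simpleQuantity_mul hCf hEf, coeff_simpleQuantity_mul hCf hEf,
      ncard_eq_of_mem_block (isSSet_of_mem_D hC) (isSSet_of_mem_D hE) hCf hEf]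
    rw [← eq_block hB hh]
    exact hg

/-- Schur's theorem on multipliers. Over `ZMod p` the `p`-th power of a sum of commuting elements is
the sum of the `p`-th powers; injectivity keeps all its coefficients equal to `0` or `1`. -/
theorem IsSSet.image_pow_prime {G : Type*} [CommGroup G] {A : SchurRing F G} {S : Set G}
    (hS : A.IsSSet S) (hSf : S.Finite) {p : ℕ} (hp : p.Prime)
    (hinj : Function.Injective fun g : G => g ^ p) : A.IsSSet ((fun g : G => g ^ p) '' S) := by
  classical
  have := Fact.mk hp
  -- Being an `S`-set only depends on the partition, so the base field may be replaced.
  have hB : ∀ T : Set G, A.IsSSet T ↔ (A.changeField (ZMod p)).IsSSet T := fun T => Iff.rfl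
  rw [hB] at hS ⊢
  have hchar : CharP (MonoidAlgebra (ZMod p) G) p :=
    charP_of_injective_algebraMap (algebraMap (ZMod p) (MonoidAlgebra (ZMod p) G)).injective p
  rw [isSSet_iff_simpleQuantity (hSf.image _), ← mapDomain_simpleQuantity hinj hSf]
  rw [isSSet_iff_simpleQuantity hSf] at hS
  convert pow_mem_carrier _ hS p
  have h1 : simpleQuantity (ZMod p) S = ∑ c ∈ hSf.toFinset, MonoidAlgebra.single c 1 :=
    finsum_mem_eq_finite_toFinset_sum _ hSf
  have h2 : simpleQuantity (ZMod p) ((fun g : G => g ^ p) '' S) =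
      ∑ c ∈ hSf.toFinset, MonoidAlgebra.single (c ^ p) 1 := by
    rw [simpleQuantity, finsum_mem_eq_finite_toFinset_sum _ (hSf.image _)]
    have : (hSf.image fun g => g ^ p).toFinset = hSf.toFinset.image fun g => g ^ p := by ext; simp
    rw [this, Finset.sum_image fun _ _ _ _ h => hinj h]
  rw [mapDomain_simpleQuantity hinj hSf, h2, h1, sum_pow_char]
  simp [MonoidAlgebra.single_pow]

theorem IsSSet.image_pow {G : Type*} [CommGroup G] [IsMulTorsionFree G] {A : SchurRing F G}
    {S : Set G} (hS : A.IsSSet S) (hSf : S.Finite) {n : ℕ} (hn : n ≠ 0) :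
    A.IsSSet ((fun g : G => g ^ n) '' S) := by
  induction n using Nat.recOnMul generalizing S with
  | zero => exact absurd rfl hn
  | one => simpa using hS
  | prime p hp => exact hS.image_pow_prime hSf hp (pow_left_injective hp.ne_zero)
  | mul a b iha ihb =>
    have := ihb (iha hS hSf (left_ne_zero_of_mul hn)) (hSf.image _) (right_ne_zero_of_mul hn)
    rw [Set.image_image] at this
    simpa [pow_mul] using this

end charZero

/-! ### Schur rings on subgroups and quotients -/

/-- The Schur ring induced on `X` by a Schur ring over `G`, along an injective homomorphism whose
range is an `S`-subgroup. -/
def comap (A : SchurRing F G) {X : Type*} [Group X] (f : X →* G) (hf : Function.Injective f)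
    (hr : A.IsSSet (Set.range f)) : SchurRing F X :=
  have hpre : ∀ x, f '' (f ⁻¹' A.block (f x)) = A.block (f x) := fun x =>
    Set.image_preimage_eq_of_subset (hr _ ⟨x, rfl⟩)
  have hpart : Setoid.IsPartition {C : Set X | f '' C ∈ A.D} := by
    refine ⟨fun h => A.isPartition.1 (by simpa using h), fun x => ?_⟩
    refine ⟨f ⁻¹' A.block (f x), ⟨?_, A.mem_block (f x)⟩, ?_⟩
    · change f '' _ ∈ A.D
      rw [hpre]
      exact A.block_mem_D _
    · rintro C ⟨hC, hx⟩
      rw [← eq_block hC ⟨x, hx, rfl⟩, Set.preimage_image_eq _ hf]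
  have hfin : ∀ C ∈ {C : Set X | f '' C ∈ A.D}, C.Finite := fun C hC =>
    (A.finite_of_mem _ hC).of_finite_image hf.injOn
  { D := {C | f '' C ∈ A.D}
    isPartition := hpart
    finite_of_mem := hfin
    one_mem := by simpa using A.one_mem
    inv_mem := by
      intro C hC
      have := A.inv_mem _ hC
      rwa [← Set.image_inv] at this
    mul_mem := by
      intro C hC E hE
      rw [mem_span_simpleQuantity_iff hpart hfin]
      intro B hB g hg h hh
      have := (mem_span_simpleQuantity_iff A.isPartition A.finite_of_mem _).1
        (A.mul_mem _ hC _ hE) _ hB (f g) ⟨g, hg, rfl⟩ (f h) ⟨h, hh, rfl⟩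
      rw [← mapDomain_simpleQuantity hf (hfin C hC), ← mapDomain_simpleQuantity hf (hfin E hE),
        ← MonoidAlgebra.mapDomain_mul] at this
      simpa [MonoidAlgebra.mapDomain, Finsupp.mapDomain_apply hf] using this }

theorem mem_comap_D {X : Type*} [Group X] {f : X →* G} (hf : Function.Injective f)
    (hr : A.IsSSet (Set.range f)) {C : Set X} : C ∈ (A.comap f hf hr).D ↔ f '' C ∈ A.D := Iff.rfl

theorem mem_block_comap {X : Type*} [Group X] {f : X →* G} (hf : Function.Injective f)
    (hr : A.IsSSet (Set.range f)) {x y : X} :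
    y ∈ (A.comap f hf hr).block x ↔ f y ∈ A.block (f x) := by
  have := eq_block ((mem_comap_D hf hr).1 ((A.comap f hf hr).block_mem_D x))
    ⟨x, mem_block _ x, rfl⟩
  rw [← this]
  simp [hf.eq_iff]

section map

variable {Q : Type*} [Group Q] {π : G →* Q}

/-- A basic set times the kernel is an `S`-set, so it swallows every basic set that it meets. -/
theorem image_block_eq [CharZero F] (hk : A.IsSSet (π.ker : Set G)) {g h : G} {u : Q}
    (hg : u ∈ π '' A.block g) (hh : u ∈ π '' A.block h) : π '' A.block g = π '' A.block h := by
  have key : ∀ {g h : G} {u : Q}, u ∈ π '' A.block g → u ∈ π '' A.block h →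
      π '' A.block g ⊆ π '' A.block h := by
    rintro g h _ ⟨x, hx, rfl⟩ ⟨y, hy, hxy⟩
    have h1 : x ∈ A.block h * (π.ker : Set G) := by
      refine ⟨y, hy, y⁻¹ * x, ?_, by simp⟩
      simp [MonoidHom.mem_ker, hxy]
    have h2 := ((isSSet_block h).mul hk) x h1
    rw [block_eq hx] at h2
    rintro _ ⟨z, hz, rfl⟩
    obtain ⟨y', hy', k, hk', rfl⟩ := h2 hz
    refine ⟨y', hy', ?_⟩
    rw [map_mul, MonoidHom.mem_ker.1 hk', mul_one]
  exact (key hg hh).antisymm (key hh hg)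

/-- All nonempty fibres of `π` on a basic set have the same size, since that size is a structure
constant of the basic set with the kernel. The scalar is this size, nonzero in characteristic zero.
-/
theorem exists_smul_mapDomain_eq [CharZero F] (hk : A.IsSSet (π.ker : Set G))
    (hkf : (π.ker : Set G).Finite) {C : Set G} (hC : C ∈ A.D) :
    ∃ c : F, c ≠ 0 ∧
      MonoidAlgebra.mapDomain π (simpleQuantity F C) = c • simpleQuantity F (π '' C) := by
  classical
  obtain ⟨g, rfl⟩ := A.mem_D_iff.1 hC
  have hCf := A.finite_block g
  set C := A.block g
  have h1 : ∀ q, (MonoidAlgebra.mapDomain π (simpleQuantity F C)).coeff q =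
      ({c ∈ C | π c = q}.ncard : F) := by
    intro q
    have hs : simpleQuantity F C = ∑ c ∈ hCf.toFinset, MonoidAlgebra.single c 1 :=
      finsum_mem_eq_finite_toFinset_sum _ hCf
    have hm : MonoidAlgebra.mapDomain π (simpleQuantity F C) =
        ∑ c ∈ hCf.toFinset, MonoidAlgebra.single (π c) 1 := by
      rw [hs]
      induction hCf.toFinset using Finset.induction_on with
      | empty => simp
      | insert a s ha ih => rw [Finset.sum_insert ha, Finset.sum_insert ha,
          MonoidAlgebra.mapDomain_add, ih, MonoidAlgebra.mapDomain_single]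
    rw [hm, MonoidAlgebra.coeff_sum, Finsupp.finsetSum_apply]
    simp only [MonoidAlgebra.coeff_single, Finsupp.single_apply]
    rw [Finset.sum_boole, ← Set.ncard_coe_finset]
    congr 2
    ext c
    simp
  have h2 : ∀ u, {c ∈ C | π c = π u} = {c ∈ C | c⁻¹ * u ∈ (π.ker : Set G)} := by
    intro u
    ext c
    simp only [Set.mem_ofPred_eq, SetLike.mem_coe, MonoidHom.mem_ker, map_mul, map_inv,
      inv_mul_eq_one]
  have h3 : ∀ u ∈ C, {c ∈ C | π c = π u}.ncard = {c ∈ C | π c = π g}.ncard := by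
    intro u hu
    rw [h2, h2]
    exact ncard_eq_of_mem_block (isSSet_block g) hk hCf hkf hu
  have h4 : ({c ∈ C | π c = π g}.ncard : F) ≠ 0 := by
    rw [Nat.cast_ne_zero]
    exact Set.ncard_ne_zero_of_mem (a := g) ⟨A.mem_block g, rfl⟩ (hCf.subset fun _ h => h.1)
  refine ⟨({c ∈ C | π c = π g}.ncard : F), h4, ?_⟩
  apply MonoidAlgebra.coeff_injective
  ext q
  rw [MonoidAlgebra.coeff_smul_apply, coeff_simpleQuantity (hCf.image π), h1]
  split_ifs with hq
  · obtain ⟨u, hu, rfl⟩ := hq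
    rw [h3 u hu, smul_eq_mul, mul_one]
  · have : {c ∈ C | π c = q} = ∅ := by
      ext c
      simp only [Set.mem_ofPred_eq, Set.mem_empty_iff_false, iff_false, not_and]
      exact fun hc hcq => hq ⟨c, hc, hcq⟩
    simp [this]

/-- The quotient Schur ring along a surjective homomorphism whose kernel is a finite
`S`-subgroup. -/
def map [CharZero F] (A : SchurRing F G) (π : G →* Q) (hπ : Function.Surjective π)
    (hk : A.IsSSet (π.ker : Set G)) (hkf : (π.ker : Set G).Finite) : SchurRing F Q :=
  have hpart : Setoid.IsPartition ((fun C : Set G => π '' C) '' A.D) := by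
    refine ⟨?_, fun q => ?_⟩
    · rintro ⟨C, hC, h⟩
      simp only [Set.image_eq_empty] at h
      exact A.isPartition.1 (h ▸ hC)
    · obtain ⟨g, rfl⟩ := hπ q
      refine ⟨π '' A.block g, ⟨⟨_, A.block_mem_D g, rfl⟩, g, A.mem_block g, rfl⟩, ?_⟩
      rintro _ ⟨⟨C, hC, rfl⟩, hg⟩
      obtain ⟨h, rfl⟩ := A.mem_D_iff.1 hC
      exact image_block_eq hk hg ⟨g, A.mem_block g, rfl⟩
  have hfin : ∀ C ∈ (fun C : Set G => π '' C) '' A.D, C.Finite := by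
    rintro _ ⟨C, hC, rfl⟩
    exact (A.finite_of_mem C hC).image π
  { D := (fun C : Set G => π '' C) '' A.D
    isPartition := hpart
    finite_of_mem := hfin
    one_mem := ⟨{1}, A.one_mem, by simp⟩
    inv_mem := by
      rintro _ ⟨C, hC, rfl⟩
      exact ⟨C⁻¹, A.inv_mem C hC, Set.image_inv π C⟩
    mul_mem := by
      rintro _ ⟨C, hC, rfl⟩ _ ⟨E, hE, rfl⟩
      have key : ∀ x ∈ A.carrier, MonoidAlgebra.mapDomain π x ∈
          Submodule.span F (simpleQuantity F '' ((fun C : Set G => π '' C) '' A.D)) := by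
        intro x hx
        induction hx using Submodule.span_induction with
        | mem y hy =>
          obtain ⟨B, hB, rfl⟩ := hy
          obtain ⟨b, -, hb⟩ := exists_smul_mapDomain_eq hk hkf hB
          rw [hb]
          exact Submodule.smul_mem _ _ (Submodule.subset_span ⟨_, ⟨B, hB, rfl⟩, rfl⟩)
        | zero => rw [MonoidAlgebra.mapDomain_zero]; exact Submodule.zero_mem _
        | add y z _ _ hy hz => rw [MonoidAlgebra.mapDomain_add]; exact Submodule.add_mem _ hy hz
        | smul c y _ hy =>
          have : MonoidAlgebra.mapDomain π (c • y) = c • MonoidAlgebra.mapDomain π y := by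
            apply MonoidAlgebra.coeff_injective
            simp [MonoidAlgebra.mapDomain, Finsupp.mapDomain_smul]
          rw [this]
          exact Submodule.smul_mem _ _ hy
      obtain ⟨c, hc0, hc⟩ := exists_smul_mapDomain_eq hk hkf hC
      obtain ⟨e, he0, he⟩ := exists_smul_mapDomain_eq hk hkf hE
      have := key _ (A.mul_mem C hC E hE)
      rw [MonoidAlgebra.mapDomain_mul, hc, he, smul_mul_smul_comm] at this
      exact (Submodule.smul_mem_iff _ (mul_ne_zero hc0 he0)).1 this }

theorem mem_map_D [CharZero F] (hπ : Function.Surjective π) (hk : A.IsSSet (π.ker : Set G))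
    (hkf : (π.ker : Set G).Finite) {C : Set Q} :
    C ∈ (A.map π hπ hk hkf).D ↔ ∃ E ∈ A.D, π '' E = C := Iff.rfl

theorem block_map [CharZero F] (hπ : Function.Surjective π) (hk : A.IsSSet (π.ker : Set G))
    (hkf : (π.ker : Set G).Finite) (g : G) :
    (A.map π hπ hk hkf).block (π g) = π '' A.block g :=
  (eq_block ((mem_map_D hπ hk hkf).2 ⟨_, A.block_mem_D g, rfl⟩) ⟨g, A.mem_block g, rfl⟩).symm

end map

end SchurRing

/-! ### Singleton basic sets and Schur rings over the infinite cyclic group -/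

namespace SchurRing

variable {F : Type*} [Field F] [CharZero F]

/-- The elements that form a basic set on their own. -/
def thin {G : Type*} [Group G] (A : SchurRing F G) : Subgroup G where
  carrier := {g | A.block g = {g}}
  one_mem' := A.block_one
  inv_mem' := by
    intro g hg
    rw [Set.mem_ofPred_eq] at hg ⊢
    rw [block_inv, hg, Set.inv_singleton]
  mul_mem' := by
    intro g h hg hh
    rw [Set.mem_ofPred_eq] at hg hh ⊢
    have h1 : A.IsSSet ({g} * {h} : Set G) := by
      rw [← hg, ← hh]
      exact (isSSet_block g).mul (isSSet_block h)
    rw [Set.singleton_mul_singleton] at h1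
    exact (h1 _ rfl).antisymm (Set.singleton_subset_iff.2 (A.mem_block _))

theorem mem_thin {G : Type*} [Group G] {A : SchurRing F G} {g : G} :
    g ∈ A.thin ↔ A.block g = {g} := Iff.rfl

/-- One inclusion comes from products of `S`-sets; the other is the same inclusion for `g⁻¹`. -/
theorem block_mul_of_mem_thin {G : Type*} [Group G] {A : SchurRing F G} {g : G}
    (hg : g ∈ A.thin) (h : G) : A.block (g * h) = {g} * A.block h := by
  have key : ∀ {g : G}, g ∈ A.thin → ∀ h, A.block (g * h) ⊆ {g} * A.block h := by
    intro g hg h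
    have h1 := (isSSet_block (A := A) g).mul (isSSet_block h)
    rw [mem_thin.1 hg] at h1
    exact h1 _ (Set.mul_mem_mul rfl (A.mem_block h))
  refine (key hg h).antisymm ?_
  have h2 := key (A.thin.inv_mem hg) (g * h)
  rw [inv_mul_cancel_left] at h2
  rintro _ ⟨_, rfl, u, hu, rfl⟩
  obtain ⟨_, rfl, v, hv, rfl⟩ := h2 hu
  simpa using hv

/-- Let `w` have maximal absolute exponent `N` in the basic set of `z`. The `N`-th powers of that
basic set form an `S`-set containing `z ^ N`, which is `w` or `w⁻¹`, and so containing `z` or `z⁻¹`.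
Hence `N = 1`, and the basic set of `z` is `{z}` or `{z, z⁻¹}`. -/
theorem block_of_infinite_cyclic (B : SchurRing F Z) :
    (∀ g u, u ∈ B.block g ↔ u = g) ∨ (∀ g u, u ∈ B.block g ↔ u = g ∨ u = g⁻¹) := by
  set z : Z := Multiplicative.ofAdd 1 with hz
  have hgen : ∀ g : Z, z ^ (Multiplicative.toAdd g) = g := by
    intro g
    rw [hz, ← ofAdd_zsmul]
    simp
  obtain ⟨w, hw, hmax⟩ := Set.exists_max_image (B.block z)
    (fun u => (Multiplicative.toAdd u).natAbs) (B.finite_block z) ⟨z, B.mem_block z⟩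
  have hN : (Multiplicative.toAdd w).natAbs = 1 := by
    set N := (Multiplicative.toAdd w).natAbs with hNdef
    have hN0 : N ≠ 0 := by
      have := hmax z (B.mem_block z)
      have h1 : (Multiplicative.toAdd z).natAbs = 1 := by simp [hz]
      omega
    have hS := (isSSet_block (A := B) z).image_pow (B.finite_block z) hN0
    have hsub := hS (z ^ N) ⟨z, B.mem_block z, rfl⟩
    have hcases : w = z ^ N ∨ w⁻¹ = z ^ N := by
      rcases Int.natAbs_eq (Multiplicative.toAdd w) with h | h
      · left
        rw [← hgen w, h, ← hNdef, zpow_natCast]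
      · right
        rw [← hgen w, h, ← hNdef, zpow_neg, inv_inv, zpow_natCast]
    have hd : ∃ c : Z, c ^ N = z ∨ c ^ N = z⁻¹ := by
      rcases hcases with h | h
      · rw [← h] at hsub
        obtain ⟨c, -, hc⟩ := hsub (mem_block_symm hw)
        exact ⟨c, Or.inl hc⟩
      · rw [← h, block_inv] at hsub
        obtain ⟨c, -, hc⟩ := hsub (Set.inv_mem_inv.2 (mem_block_symm hw))
        exact ⟨c, Or.inr hc⟩
    obtain ⟨c, hc⟩ := hd
    have hdvd : (N : ℤ) ∣ 1 := by
      rcases hc with hc | hc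
      · refine ⟨Multiplicative.toAdd c, ?_⟩
        simpa [hz] using (congrArg Multiplicative.toAdd hc).symm
      · refine ⟨-Multiplicative.toAdd c, ?_⟩
        have := congrArg Multiplicative.toAdd hc
        simp [hz] at this
        linarith
    exact_mod_cast Int.eq_one_of_dvd_one (by positivity) hdvd
  have hsub : ∀ u ∈ B.block z, u = z ∨ u = z⁻¹ := by
    intro u hu
    have h1 := hmax u hu
    have h0 : u ≠ 1 := by
      rintro rfl
      have := mem_block_symm hu
      rw [block_one] at this
      simp [hz] at this
    have h0' : Multiplicative.toAdd u ≠ 0 := fun h => h0 (by rw [← hgen u, h, zpow_zero])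
    have : Multiplicative.toAdd u = 1 ∨ Multiplicative.toAdd u = -1 := by omega
    rcases this with h | h
    · left; rw [← hgen u, h, zpow_one]
    · right; rw [← hgen u, h, zpow_neg, zpow_one]
  have hall : z ∈ B.thin → ∀ g, B.block g = {g} := by
    intro h g
    rw [← mem_thin, ← hgen g]
    exact zpow_mem h _
  by_cases hzinv : z⁻¹ ∈ B.block z
  · right
    have hz1 : z ∉ B.thin := by
      intro h
      rw [mem_thin.1 h] at hzinv
      exact absurd (congrArg Multiplicative.toAdd (Set.mem_singleton_iff.1 hzinv)) (by simp [hz])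
    have hC : B.block z = {z, z⁻¹} := by
      ext u
      constructor
      · exact hsub u
      · rintro (rfl | rfl)
        · exact B.mem_block _
        · exact hzinv
    have hpair : ∀ g : Z, ∀ u ∈ B.block g, u = g ∨ u = g⁻¹ := by
      intro g u hu
      by_cases hg : g = 1
      · rw [hg, block_one] at hu
        left; rw [hg]; exact hu
      have hn : (Multiplicative.toAdd g).natAbs ≠ 0 := by
        intro h
        apply hg
        rw [← hgen g, Int.natAbs_eq_zero.1 h, zpow_zero]
      have hS := (isSSet_block (A := B) z).image_pow (B.finite_block z) hn
      rw [hC, Set.image_pair] at hS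
      rcases Int.natAbs_eq (Multiplicative.toAdd g) with h | h
      · have hg' : z ^ (Multiplicative.toAdd g).natAbs = g := by
          rw [← zpow_natCast, ← h, hgen]
        rw [inv_pow, hg'] at hS
        exact hS g (Or.inl rfl) hu
      · have hg' : z ^ (Multiplicative.toAdd g).natAbs = g⁻¹ := by
          rw [← zpow_natCast, ← inv_inj, ← zpow_neg, ← h, hgen, inv_inv]
        rw [inv_pow, hg', inv_inv] at hS
        exact (hS g (Or.inr rfl) hu).symm
    intro g u
    refine ⟨hpair g u, ?_⟩
    rintro (h | h)
    · rw [h]; exact B.mem_block _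
    rw [h]
    clear h u
    -- If `g ≠ 1` were a singleton basic set, the basic set of `g * z` would be `{g * z, g * z⁻¹}`,
    -- yet it lies in `{g * z, (g * z)⁻¹}`. That makes `g * z`, and with it `z`, a singleton.
    by_contra hn
    have hg1 : g ≠ 1 := by
      rintro rfl
      simp at hn
    have hg : g ∈ B.thin := by
      rw [mem_thin]
      refine Set.eq_singleton_iff_unique_mem.2 ⟨B.mem_block g, fun u hu => ?_⟩
      rcases hpair g u hu with h | h
      · exact h
      · rw [h] at hu; exact absurd hu hn
    apply hz1
    have hgz : g * z ∈ B.thin := by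
      rw [mem_thin]
      refine Set.eq_singleton_iff_unique_mem.2 ⟨B.mem_block _, fun u hu => ?_⟩
      rcases hpair _ u hu with h | h
      · exact h
      · rw [block_mul_of_mem_thin hg, hC, Set.singleton_mul] at hu
        obtain ⟨v, rfl | rfl, rfl⟩ := hu
        · rfl
        · exfalso
          apply hg1
          have : g ^ 2 = 1 := by
            rw [mul_inv] at h
            have := mul_right_cancel h
            rw [pow_two]
            nth_rewrite 1 [this]
            simp
          exact (pow_eq_one_iff_left two_ne_zero).1 this
    simpa using B.thin.mul_mem (B.thin.inv_mem hg) hgz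
  · left
    have : z ∈ B.thin := by
      rw [mem_thin]
      refine Set.eq_singleton_iff_unique_mem.2 ⟨B.mem_block z, fun u hu => ?_⟩
      rcases hsub u hu with h | h
      · exact h
      · rw [h] at hu; exact absurd hu hzinv
    intro g u
    rw [hall this g]
    rfl

end SchurRing

/-! ### Elementary facts about `Z × Z₃` -/

theorem Z3.pow_three (b : Z3) : b ^ 3 = 1 := by
  revert b; decide

theorem Z3.eq_one_or (b : Z3) : b = 1 ∨ b = genA ∨ b = genA ^ 2 := by
  revert b; decide

theorem Z3.eq_or_eq_inv {b c : Z3} (hb : b ≠ 1) (hc : c ≠ 1) : c = b ∨ c = b⁻¹ := by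
  revert b c; decide

theorem eq_one_of_sq_eq_one {g : Z × Z3} (h : g * g = 1) : g = 1 := by
  obtain ⟨n, b⟩ := g
  rw [Prod.mk_mul_mk, Prod.mk_eq_one] at h
  have hn : n = 1 := by
    rw [← pow_two] at h
    exact (pow_eq_one_iff_left two_ne_zero).1 h.1
  have hb : b = 1 := by
    have key : ∀ b : Z3, b * b = 1 → b = 1 := by decide
    exact key b h.2
  rw [hn, hb]; rfl

theorem Z.ne_inv {n : Z} (hn : n ≠ 1) : n ≠ n⁻¹ := by
  intro h
  apply hn
  rw [← pow_eq_one_iff_left two_ne_zero (a := n), pow_two]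
  nth_rewrite 1 [h]
  simp

theorem eq_or_eq_of_fst_eq {p q r s : Z × Z3} (hq : q.1 = p.1) (hr : r.1 = p.1) (hs : s.1 = p.1) :
    p = q ∨ p = r ∨ p = s ∨ q = r ∨ q = s ∨ r = s := by
  have key : ∀ a b c d : Z3, a = b ∨ a = c ∨ a = d ∨ b = c ∨ b = d ∨ c = d := by decide
  simpa only [Prod.ext_iff, hq, hr, hs, true_and] using key p.2 q.2 r.2 s.2

/-! ### Schur rings over `Z × Z₃`: torsion, quotient and cosets -/

namespace SchurRing

variable {F : Type*} [Field F] [CharZero F] {A : SchurRing F (Z × Z3)}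

/-- Since `(1, b) ^ 2 = (1, b)⁻¹`, each `u` in the basic set has `u⁻¹ = c ^ 2` with `c` in the same
basic set. The exponent of `c` is half as large in absolute value, so descent ends at zero. -/
theorem fst_eq_one_of_mem_block {b : Z3} {u : Z × Z3} (hu : u ∈ A.block (1, b)) : u.1 = 1 := by
  have hinj : Function.Injective fun g : Z × Z3 => g ^ 2 := by
    intro g h hgh
    have : (g * h⁻¹) * (g * h⁻¹) = 1 := by
      rw [← pow_two, mul_pow, inv_pow]
      simpa using mul_inv_eq_one.2 hgh
    exact mul_inv_eq_one.1 (eq_one_of_sq_eq_one this)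
  have hS := (isSSet_block (A := A) (1, b)).image_pow_prime (A.finite_block _) Nat.prime_two hinj
  have hinv : (1, b) ^ 2 = ((1, b) : Z × Z3)⁻¹ := by
    rw [eq_inv_iff_mul_eq_one, ← pow_succ]
    ext <;> simp [Z3.pow_three]
  have hsub := hS _ ⟨_, A.mem_block _, rfl⟩
  simp only at hsub
  rw [hinv, block_inv] at hsub
  induction hn : (Multiplicative.toAdd u.1).natAbs using Nat.strong_induction_on generalizing u with
  | _ n ih =>
    obtain ⟨c, hc, hcu⟩ := hsub (Set.inv_mem_inv.2 hu)
    have h1 : 2 * Multiplicative.toAdd c.1 = -Multiplicative.toAdd u.1 := by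
      have := congrArg (fun g : Z × Z3 => Multiplicative.toAdd g.1) hcu
      simpa using this
    by_cases h0 : Multiplicative.toAdd u.1 = 0
    · exact h0
    · exfalso
      have h2 := ih _ (by omega) hc rfl
      rw [h2] at h1
      simp at h1
      exact h0 (by rw [h1]; rfl)

theorem isSSet_fst_eq_one : A.IsSSet {g | g.1 = 1} := by
  rintro ⟨n, b⟩ hg u hu
  rw [Set.mem_ofPred_eq] at hg
  simp only at hg
  subst hg
  exact fst_eq_one_of_mem_block hu

theorem torsion_cases :
    (∀ b : Z3, ((1 : Z), b) ∈ A.thin) ∨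
      ∀ (b : Z3) (u : Z × Z3), u ∈ A.block (1, b) ↔ u = (1, b) ∨ u = (1, b)⁻¹ := by
  by_cases h : ∀ b : Z3, ((1 : Z), b) ∈ A.thin
  · exact Or.inl h
  right
  have hsub : ∀ (b : Z3) (u : Z × Z3), u ∈ A.block (1, b) → u = (1, b) ∨ u = (1, b)⁻¹ := by
    intro b u hu
    by_cases hb : b = 1
    · subst hb
      rw [← Prod.one_eq_mk, block_one] at hu
      exact Or.inl hu
    have hu1 := fst_eq_one_of_mem_block hu
    have hu2 : u.2 ≠ 1 := by
      intro h2
      have : u = 1 := Prod.ext hu1 h2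
      subst this
      have := mem_block_symm hu
      rw [block_one] at this
      exact hb (congrArg Prod.snd this)
    rcases Z3.eq_or_eq_inv hb hu2 with h2 | h2
    · exact Or.inl (Prod.ext hu1 h2)
    · exact Or.inr (Prod.ext (by simpa using hu1) h2)
  have hinv : ∀ b : Z3, ((1, b) : Z × Z3)⁻¹ ∈ A.block (1, b) := by
    intro b
    by_contra hn
    have hb : ((1 : Z), b) ∈ A.thin := by
      rw [mem_thin]
      refine Set.eq_singleton_iff_unique_mem.2 ⟨A.mem_block _, fun u hu => ?_⟩
      rcases hsub b u hu with h | h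
      · exact h
      · rw [h] at hu; exact absurd hu hn
    have hb1 : b ≠ 1 := by
      rintro rfl
      rw [← Prod.one_eq_mk, block_one] at hn
      simp at hn
    apply h
    intro c
    by_cases hc : c = 1
    · subst hc; exact A.thin.one_mem
    · rcases Z3.eq_or_eq_inv hb1 hc with rfl | rfl
      · exact hb
      · simpa using A.thin.inv_mem hb
  intro b u
  refine ⟨hsub b u, ?_⟩
  rintro (rfl | rfl)
  · exact A.mem_block _
  · exact hinv b

theorem ker_fst_eq : ((MonoidHom.fst Z Z3).ker : Set (Z × Z3)) = {g | g.1 = 1} := by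
  exact Set.ext fun g => MonoidHom.mem_ker

theorem finite_fst_eq (n : Z) : {g : Z × Z3 | g.1 = n}.Finite := by
  refine (Set.finite_range fun b : Z3 => ((n, b) : Z × Z3)).subset ?_
  rintro ⟨m, b⟩ rfl
  exact ⟨b, rfl⟩

theorem quotient_cases (A : SchurRing F (Z × Z3)) :
    (∀ g, ∀ u ∈ A.block g, u.1 = g.1) ∨
      ∀ g, (∀ u ∈ A.block g, u.1 = g.1 ∨ u.1 = g.1⁻¹) ∧ ∃ u ∈ A.block g, u.1 = g.1⁻¹ := by
  have hk : A.IsSSet ((MonoidHom.fst Z Z3).ker : Set (Z × Z3)) := by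
    rw [ker_fst_eq]; exact isSSet_fst_eq_one
  have hkf : ((MonoidHom.fst Z Z3).ker : Set (Z × Z3)).Finite := by
    rw [ker_fst_eq]; exact finite_fst_eq 1
  have hsurj : Function.Surjective (MonoidHom.fst Z Z3) := Prod.fst_surjective
  have hb := block_map hsurj hk hkf
  rcases block_of_infinite_cyclic (A.map _ hsurj hk hkf) with h | h
  · left
    intro g u hu
    exact (h (MonoidHom.fst Z Z3 g) u.1).1 (by rw [hb]; exact ⟨u, hu, rfl⟩)
  · right
    intro g
    refine ⟨fun u hu => (h (MonoidHom.fst Z Z3 g) u.1).1 (by rw [hb]; exact ⟨u, hu, rfl⟩), ?_⟩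
    have := (h (MonoidHom.fst Z Z3 g) g.1⁻¹).2 (Or.inr rfl)
    rw [hb] at this
    exact this

/-- The basic set of `x` contains no other element of the `Z₃`-coset of `x`. -/
def IsTransversal (A : SchurRing F (Z × Z3)) (x : Z × Z3) : Prop :=
  ∀ y ∈ A.block x, y.1 = x.1 → y = x

/-- `Z₃` without the identity is an `S`-set. Its product with the basic set is an `S`-set that meets
the basic set as soon as one element has a companion in its coset; then it contains the whole basic
set. -/
theorem exists_ne_of_exists_ne {g u v w : Z × Z3} (hu : u ∈ A.block g) (hv : v ∈ A.block g)
    (huv : u ≠ v) (h : u.1 = v.1) (hw : w ∈ A.block g) : ∃ w' ∈ A.block g, w' ≠ w ∧ w'.1 = w.1 := by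
  have hT : A.IsSSet ({g : Z × Z3 | g.1 = 1} \ {1}) := isSSet_fst_eq_one.diff isSSet_one
  have h1 : u ∈ A.block g * ({g : Z × Z3 | g.1 = 1} \ {1}) := by
    refine ⟨v, hv, v⁻¹ * u, ⟨?_, ?_⟩, by simp⟩
    · simp [h]
    · simp only [Set.mem_singleton_iff, inv_mul_eq_one]
      exact fun h => huv h.symm
  have h2 := ((isSSet_block (A := A) g).mul hT) u h1
  rw [block_eq hu] at h2
  obtain ⟨w', hw', t, ⟨ht, ht1⟩, rfl⟩ := h2 hw
  refine ⟨w', hw', ?_, ?_⟩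
  · simpa using ht1
  · have : t.1 = 1 := ht
    simp [this]

theorem IsTransversal.eq {x u v : Z × Z3} (hx : A.IsTransversal x) (hu : u ∈ A.block x)
    (hv : v ∈ A.block x) (h : u.1 = v.1) : u = v := by
  by_contra huv
  obtain ⟨w, hw, hne, hw1⟩ := exists_ne_of_exists_ne hu hv huv h (A.mem_block x)
  exact hne (hx w hw hw1)

omit [CharZero F] in
-- A coset has three points, so when it is cut into at least two parts, one part is a single point.
theorem exists_isTransversal {x y : Z × Z3} (hy : y ∉ A.block x) (hyx : y.1 = x.1) :
    ∃ x', x'.1 = x.1 ∧ A.IsTransversal x' := by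
  by_cases hx : A.IsTransversal x
  · exact ⟨x, rfl, hx⟩
  refine ⟨y, hyx, fun y' hy' hy1 => ?_⟩
  simp only [IsTransversal, not_forall] at hx
  obtain ⟨x', hx', hx1, hne⟩ := hx
  have h1 : y' ∉ A.block x := fun h => hy (by
    rw [← block_eq h]; exact mem_block_symm hy')
  rcases eq_or_eq_of_fst_eq hx1 hyx (hy1.trans hyx) with h | h | h | h | h | h
  · exact absurd h.symm hne
  · exact absurd (h ▸ A.mem_block x) hy
  · exact absurd (h ▸ A.mem_block x) h1
  · exact absurd (h ▸ hx') hy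
  · exact absurd (h ▸ hx') h1
  · exact h.symm

theorem exists_zpowers_eq (H : Subgroup Z) : ∃ h : Z, H = Subgroup.zpowers h := by
  obtain ⟨h, hh⟩ := IsCyclic.exists_generator (α := H)
  refine ⟨h, le_antisymm (fun g hg => ?_) ?_⟩
  · obtain ⟨k, hk⟩ := hh ⟨g, hg⟩
    exact ⟨k, by simpa using congrArg Subtype.val hk⟩
  · rw [Subgroup.zpowers_le]
    exact h.2

/-- Every basic set outside `⟨x⟩Z₃` contains a `Z₃`-coset. -/
def IsFullOutside (A : SchurRing F (Z × Z3)) (x : Z × Z3) : Prop :=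
  ∀ g : Z × Z3, g.1 ∉ Subgroup.zpowers x.1 → ∀ u : Z × Z3, u.1 = g.1 → u ∈ A.block g

/-- Basic sets stay inside cosets here, so a point alone in its coset is a singleton basic set. Take
`x` to be such a singleton over a generator of the projection of `thin`; translating by `x ^ m` then
carries the basic sets of `Z₃` to the other cosets. -/
theorem structure_of_quotient_discrete (hD : ∀ g, ∀ u ∈ A.block g, u.1 = g.1) :
    ∃ x : Z × Z3, A.IsFullOutside x ∧
      ((∀ (m : ℤ) (b : Z3) (u : Z × Z3),
          u ∈ A.block (x ^ m * (1, b)) ↔ u = x ^ m * (1, b)) ∨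
        ∀ (m : ℤ) (b : Z3) (u : Z × Z3), u ∈ A.block (x ^ m * (1, b)) ↔
          u = x ^ m * (1, b) ∨ u = x ^ m * (1, b)⁻¹) := by
  obtain ⟨h, hh⟩ := exists_zpowers_eq (A.thin.map (MonoidHom.fst Z Z3))
  obtain ⟨x, hx, rfl⟩ : h ∈ A.thin.map (MonoidHom.fst Z Z3) := by
    rw [hh]; exact Subgroup.mem_zpowers h
  refine ⟨x, ?_, ?_⟩
  · intro g hg u hu
    by_contra hn
    obtain ⟨y, hy, hty⟩ := exists_isTransversal hn hu
    apply hg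
    change g.1 ∈ Subgroup.zpowers (MonoidHom.fst Z Z3 x)
    rw [← hh]
    refine ⟨y, ?_, hy⟩
    change A.block y = {y}
    exact Set.eq_singleton_iff_unique_mem.2
      ⟨A.mem_block y, fun v hv => hty v hv (hD y v hv)⟩
  · have hb : ∀ (m : ℤ) (b : Z3), A.block (x ^ m * (1, b)) = {x ^ m} * A.block (1, b) :=
      fun m b => block_mul_of_mem_thin (A.thin.zpow_mem hx m) _
    rcases torsion_cases (A := A) with h | h
    · left
      intro m b u
      rw [hb, mem_thin.1 (h b), Set.singleton_mul_singleton]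
      rfl
    · right
      intro m b u
      have : A.block (1, b) = {(1, b), (1, b)⁻¹} := Set.ext (h b)
      rw [hb, this, Set.singleton_mul, Set.image_pair]
      rfl

/-- The basic set of `x` is `{x, x⁻¹}`. -/
def IsSymmPair (A : SchurRing F (Z × Z3)) (x : Z × Z3) : Prop := A.block x = {x, x⁻¹}

omit [CharZero F] in
theorem isSymmPair_one : A.IsSymmPair 1 := by simp [IsSymmPair]

omit [CharZero F] in
theorem IsSymmPair.inv {x : Z × Z3} (hx : A.IsSymmPair x) : A.IsSymmPair x⁻¹ := by
  rw [IsSymmPair] at *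
  rw [block_inv, hx]
  ext u
  simp

/-! ### The case of a symmetric quotient -/

section quotientSymmetric

variable (hS : ∀ g, (∀ u ∈ A.block g, u.1 = g.1 ∨ u.1 = g.1⁻¹) ∧ ∃ u ∈ A.block g, u.1 = g.1⁻¹)
include hS

/-- The basic set lies in `{x, x⁻¹} * {y, y⁻¹}`. Its first coordinates are those of `x * y` and its
inverse, which rules out the mixed products as `Z` is torsion-free; symmetry of the quotient then
forces the inverse in. -/
theorem IsSymmPair.mul {x y : Z × Z3} (hx : A.IsSymmPair x) (hy : A.IsSymmPair y)
    (hx1 : x.1 ≠ 1) (hy1 : y.1 ≠ 1) (hxy : (x * y).1 ≠ 1) : A.IsSymmPair (x * y) := by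
  have hW := (isSSet_block (A := A) x).mul (isSSet_block (A := A) y)
  have h1 : ∀ u ∈ A.block (x * y), u = x * y ∨ u = (x * y)⁻¹ := by
    intro u hu
    have hu1 := (hS (x * y)).1 u hu
    have hu2 := hW _ (Set.mul_mem_mul (A.mem_block x) (A.mem_block y)) hu
    rw [hx, hy] at hu2
    obtain ⟨s, hs, t, ht, rfl⟩ := hu2
    have e1 : ∀ {p q : Z}, p * q⁻¹ = p * q → q = 1 := by
      intro p q h
      by_contra hq
      exact Z.ne_inv hq (mul_left_cancel h).symm
    rcases hs with rfl | rfl <;> rcases ht with rfl | rfl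
    · exact Or.inl rfl
    · exfalso
      simp only [Prod.fst_mul, Prod.fst_inv, mul_inv] at hu1
      rcases hu1 with h | h
      · exact hy1 (e1 h)
      · exact Z.ne_inv hx1 (mul_right_cancel h)
    · exfalso
      simp only [Prod.fst_mul, Prod.fst_inv, mul_inv] at hu1
      rcases hu1 with h | h
      · exact Z.ne_inv hx1 (mul_right_cancel h).symm
      · exact Z.ne_inv hy1 (mul_left_cancel h)
    · right; rw [mul_inv]
  obtain ⟨v, hv, hv1⟩ := (hS (x * y)).2
  rw [IsSymmPair]
  refine Set.Subset.antisymm h1 ?_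
  rintro _ (rfl | rfl)
  · exact A.mem_block _
  · rcases h1 v hv with rfl | rfl
    · exact absurd hv1 (Z.ne_inv hxy)
    · exact hv

theorem IsTransversal.block_eq {x y : Z × Z3} (hx : A.IsTransversal x) (hy : y ∈ A.block x)
    (hyx : y.1 = x.1⁻¹) : A.block x = {x, y} := by
  ext u
  constructor
  · intro hu
    rcases (hS x).1 u hu with h | h
    · exact Or.inl (hx u hu h)
    · exact Or.inr (hx.eq hu hy (h.trans hyx.symm))
  · rintro (rfl | rfl)
    · exact A.mem_block _
    · exact hy

/-- The basic set is `{x, y}` with `x * y` in `Z₃`. By `hT` the inverse of `x * y` is again a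
product of two elements of `{x, y}`, and the only such product in `Z₃` is `x * y`. So `(x * y)² = 1`
and `y = x⁻¹`. -/
theorem IsTransversal.isSymmPair
    (hT : ∀ (b : Z3) (u : Z × Z3), u ∈ A.block (1, b) ↔ u = (1, b) ∨ u = (1, b)⁻¹)
    {x : Z × Z3} (hx : A.IsTransversal x) (hx1 : x.1 ≠ 1) : A.IsSymmPair x := by
  obtain ⟨y, hy, hyx⟩ := (hS x).2
  have hxy : x * y = (1, (x * y).2) := Prod.ext (by simp [hyx]) rfl
  have h1 : (x * y)⁻¹ ∈ A.block (x * y) := by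
    rw [hxy, hT]
    exact Or.inr rfl
  have hW := (isSSet_block (A := A) x).mul (isSSet_block (A := A) x)
  obtain ⟨c, hc, d, hd, hcd⟩ := hW _ (Set.mul_mem_mul (A.mem_block x) hy) h1
  simp only at hcd
  rw [hx.block_eq hS hy hyx] at hc hd
  have key : x * y = 1 := by
    have hf : c.1 * d.1 = 1 := by
      have := congrArg Prod.fst hcd
      simpa [hyx] using this
    have hcd' : c * d = x * y := by
      rcases hc with rfl | rfl <;> rcases hd with rfl | rfl
      · exact absurd (eq_inv_of_mul_eq_one_left hf) (Z.ne_inv hx1)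
      · rfl
      · exact mul_comm _ _
      · rw [hyx, ← eq_inv_iff_mul_eq_one, inv_inv] at hf
        exact absurd hf.symm (Z.ne_inv hx1)
    apply eq_one_of_sq_eq_one
    rw [← hcd'] at hcd ⊢
    nth_rewrite 1 [hcd]
    simp
  rw [IsSymmPair, hx.block_eq hS hy hyx, eq_inv_of_mul_eq_one_right key]

theorem exists_isSymmPair {x y : Z × Z3} (hy : y ∉ A.block x) (hyx : y.1 = x.1) (hx1 : x.1 ≠ 1) :
    ∃ x', x'.1 = x.1 ∧ A.IsSymmPair x' := by
  obtain ⟨x', hx', ht⟩ := exists_isTransversal hy hyx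
  rw [← hx'] at hx1 ⊢
  rcases torsion_cases (A := A) with hT | hT
  · obtain ⟨y', hy', hyx'⟩ := (hS x').2
    have hxy : x' * y' = (1, (x' * y').2) := Prod.ext (by simp [hyx']) rfl
    have hthin : x' * y' ∈ A.thin := by rw [hxy]; exact hT _
    -- With `t = x' * y'` a singleton in `Z₃`, translation gives the basic set `{t * x', t * y'}`,
    -- whose elements have product `t ^ 3 = 1`.
    refine ⟨x' * y' * x', by simp [hyx'], ?_⟩
    rw [IsSymmPair, block_mul_of_mem_thin hthin, ht.block_eq hS hy' hyx', Set.singleton_mul,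
      Set.image_pair]
    congr 2
    have h3 : (x' * y') ^ 3 = 1 := by
      rw [hxy]
      ext <;> simp [Z3.pow_three]
    rw [eq_inv_iff_mul_eq_one, ← h3]
    rw [pow_succ, pow_two]
    simp only [mul_comm, mul_left_comm]
  · exact ⟨x', rfl, ht.isSymmPair hS hT hx1⟩

theorem IsSymmPair.pow {x : Z × Z3} (hx : A.IsSymmPair x) (hx1 : x.1 ≠ 1) (n : ℕ) :
    A.IsSymmPair (x ^ (n + 1)) := by
  induction n with
  | zero => simpa using hx
  | succ n ih =>
    rw [pow_succ]
    refine ih.mul hS hx ?_ hx1 ?_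
    · rw [Prod.pow_fst, Ne, pow_eq_one_iff_left (by omega)]
      exact hx1
    · rw [← pow_succ, Prod.pow_fst, Ne, pow_eq_one_iff_left (by omega)]
      exact hx1

theorem IsSymmPair.zpow {x : Z × Z3} (hx : A.IsSymmPair x) (hx1 : x.1 ≠ 1) (m : ℤ) :
    A.IsSymmPair (x ^ m) := by
  rcases m with (_ | n) | n
  · simpa using isSymmPair_one
  · exact_mod_cast hx.pow hS hx1 n
  · rw [zpow_negSucc]
    exact (hx.pow hS hx1 n).inv

end quotientSymmetric

section quotientSymmetric

variable (hS : ∀ g, (∀ u ∈ A.block g, u.1 = g.1 ∨ u.1 = g.1⁻¹) ∧ ∃ u ∈ A.block g, u.1 = g.1⁻¹)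
include hS

/-- By `IsSymmPair.mul` the first coordinates of symmetric pairs form a subgroup, which is cyclic.
The last clause fixes the choice `x = 1` when this subgroup is trivial. -/
theorem exists_generator_of_quotient_symmetric :
    ∃ x : Z × Z3, A.IsFullOutside x ∧ A.IsSymmPair x ∧ (x.1 = 1 → x = 1) := by
  let H : Subgroup Z :=
    { carrier := {n | n = 1 ∨ ∃ x : Z × Z3, x.1 = n ∧ A.IsSymmPair x}
      one_mem' := Or.inl rfl
      inv_mem' := by
        rintro n (rfl | ⟨x, rfl, hx⟩)
        · exact Or.inl inv_one
        · exact Or.inr ⟨x⁻¹, rfl, hx.inv⟩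
      mul_mem' := by
        rintro n m (rfl | ⟨x, rfl, hx⟩) hm
        · rwa [one_mul]
        · rcases hm with rfl | ⟨y, rfl, hy⟩
          · rw [mul_one]
            exact Or.inr ⟨x, rfl, hx⟩
          · by_cases hx1 : x.1 = 1
            · rw [hx1, one_mul]
              exact Or.inr ⟨y, rfl, hy⟩
            by_cases hy1 : y.1 = 1
            · rw [hy1, mul_one]
              exact Or.inr ⟨x, rfl, hx⟩
            by_cases hxy : (x * y).1 = 1
            · exact Or.inl hxy
            · exact Or.inr ⟨x * y, rfl, hx.mul hS hy hx1 hy1 hxy⟩ }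
  have hmem : ∀ n, n ∈ H ↔ n = 1 ∨ ∃ x : Z × Z3, x.1 = n ∧ A.IsSymmPair x := fun _ => Iff.rfl
  obtain ⟨h, hh⟩ := exists_zpowers_eq H
  have hfull : ∀ x : Z × Z3, x.1 = h → A.IsFullOutside x := by
    intro x hxh g hg u hu
    by_contra hn
    apply hg
    rw [hxh, ← hh, hmem]
    by_cases hg1 : g.1 = 1
    · exact Or.inl hg1
    · exact Or.inr (exists_isSymmPair hS hn hu hg1)
  by_cases h1 : h = 1
  · exact ⟨1, hfull 1 h1.symm, isSymmPair_one, fun _ => rfl⟩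
  · have hhH : h ∈ H := by rw [hh]; exact Subgroup.mem_zpowers h
    rcases (hmem h).1 hhH with h' | ⟨x, rfl, hx⟩
    · exact absurd h' h1
    · exact ⟨x, hfull x rfl, hx, fun h' => absurd h' h1⟩

/-- Two symmetric pairs in the coset of `x` give the third, because `b⁻¹ = b * b` yields `x * b⁻¹ =
(x * b)² * x⁻¹`. Products with powers of `x` reach the remaining cosets. -/
theorem isSymmPair_zpow_mul {x : Z × Z3} (hx : A.IsSymmPair x) (hx1 : x.1 ≠ 1)
    {b : Z3} (hb : b ≠ 1) (hxb : A.IsSymmPair (x * (1, b))) {m : ℤ} (hm : m ≠ 0) (c : Z3) :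
    A.IsSymmPair (x ^ m * (1, c)) := by
  have hpow : ∀ n : ℕ, (x ^ (n + 1)).1 ≠ 1 := by
    intro n
    rw [Prod.pow_fst, Ne, pow_eq_one_iff_left (by omega)]
    exact hx1
  have hxc : ∀ c, A.IsSymmPair (x * (1, c)) := by
    intro c
    by_cases hc : c = 1
    · subst hc
      simpa [← Prod.one_eq_mk] using hx
    rcases Z3.eq_or_eq_inv hb hc with rfl | rfl
    · exact hxb
    · have h2 : A.IsSymmPair (x * (1, b) * (x * (1, b))) :=
        hxb.mul hS hxb (by simpa using hx1) (by simpa using hx1)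
          (by simpa [pow_two] using hpow 1)
      have h3 : x * (1, b⁻¹) = x * (1, b) * (x * (1, b)) * x⁻¹ := by
        have hbb : b⁻¹ = b * b := by
          have : ∀ b : Z3, b⁻¹ = b * b := by decide
          exact this b
        rw [hbb]
        ext <;> simp [mul_comm, mul_left_comm]
      rw [h3]
      refine h2.mul hS hx.inv (by simpa [pow_two] using hpow 1) (by simpa using hx1) ?_
      rw [← h3]
      simpa using hx1
  have hnat : ∀ (n : ℕ) (c : Z3), A.IsSymmPair (x ^ (n + 1) * (1, c)) := by
    intro n c
    rcases n with _ | n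
    · simpa using hxc c
    · rw [pow_succ, mul_assoc]
      refine (hx.pow hS hx1 n).mul hS (hxc c) (hpow n) (by simpa using hx1) ?_
      rw [← mul_assoc, ← pow_succ]
      simpa using hpow (n + 1)
  rcases m with (_ | n) | n
  · exact absurd rfl hm
  · exact_mod_cast hnat n c
  · have := (hnat n c⁻¹).inv
    rw [zpow_negSucc]
    convert this using 1
    rw [mul_inv]
    simp

theorem structure_of_quotient_symmetric :
    ∃ x : Z × Z3, A.IsFullOutside x ∧
      ((∀ (m : ℤ) (b : Z3) (u : Z × Z3), u ∈ A.block (x ^ m * (1, b)) ↔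
          u = x ^ m * (1, b) ∨ u = (x ^ m)⁻¹ * (1, b)) ∨
        (∀ (m : ℤ) (b : Z3) (u : Z × Z3), u ∈ A.block (x ^ m * (1, b)) ↔
          (u = x ^ m * (1, b) ∨ u = x ^ m * (1, b)⁻¹) ∨
            u = (x ^ m)⁻¹ * (1, b) ∨ u = (x ^ m)⁻¹ * (1, b)⁻¹) ∨
        ∀ (m : ℤ) (b : Z3) (u : Z × Z3), u ∈ A.block (x ^ m * (1, b)) ↔
          u = x ^ m * (1, b) ∨ u = (x ^ m * (1, b))⁻¹) := by
  obtain ⟨x, hfull, hx, hx1⟩ := exists_generator_of_quotient_symmetric hS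
  refine ⟨x, hfull, ?_⟩
  have hxm : ∀ m : ℤ, A.IsSymmPair (x ^ m) := by
    intro m
    by_cases h : x.1 = 1
    · rw [hx1 h, one_zpow]
      exact isSymmPair_one
    · exact hx.zpow hS h m
  rcases torsion_cases (A := A) with hT | hT
  · left
    intro m b u
    rw [mul_comm, block_mul_of_mem_thin (hT b), hxm m, Set.singleton_mul, Set.image_pair,
      mul_comm _ (x ^ m), mul_comm _ (x ^ m)⁻¹]
    rfl
  right
  by_cases hb : x.1 = 1 ∨ ∃ b : Z3, b ≠ 1 ∧ A.IsSymmPair (x * (1, b))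
  · right
    intro m b u
    by_cases hm : m = 0 ∨ x.1 = 1
    · have : x ^ m = 1 := by
        rcases hm with rfl | h
        · exact zpow_zero x
        · rw [hx1 h, one_zpow]
      rw [this, one_mul, hT]
    · push Not at hm
      rcases hb with h | ⟨c, hc, hxc⟩
      · exact absurd h hm.2
      · have := isSymmPair_zpow_mul hS hx hm.2 hc hxc hm.1 b
        rw [IsSymmPair] at this
        rw [this]
        rfl
  · left
    push Not at hb
    obtain ⟨hx1, hb⟩ := hb
    intro m b u
    by_cases hm : m = 0
    · subst hm
      simp only [zpow_zero, inv_one, one_mul, hT, or_self]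
    by_cases hb1 : b = 1
    · subst hb1
      have := hxm m
      rw [IsSymmPair] at this
      simp only [← Prod.one_eq_mk, inv_one, mul_one, or_self]
      rw [this]
      rfl
    have hxm1 : (x ^ m).1 ≠ 1 := by
      rw [show (x ^ m).1 = x.1 ^ m by simp, Ne, IsMulTorsionFree.zpow_eq_one_iff_left hm]
      exact hx1
    have hnV : ¬ A.IsSymmPair (x ^ m * (1, b)) := by
      intro hV
      -- A symmetric pair at a higher power would descend to `x * (1, c)` on multiplying by an
      -- inverse power of `x`.
      have key : ∀ (n : ℕ) (c : Z3), c ≠ 1 → ¬ A.IsSymmPair (x ^ (n + 1) * (1, c)) := by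
        intro n c hc hV
        apply hb c hc
        rcases n with _ | n
        · simpa using hV
        · have hpow : ∀ n : ℕ, (x ^ (n + 1)).1 ≠ 1 := by
            intro n
            rw [Prod.pow_fst, Ne, pow_eq_one_iff_left (by omega)]
            exact hx1
          have e : x * (1, c) = x ^ (n + 1 + 1) * (1, c) * (x ^ (n + 1))⁻¹ := by
            rw [pow_succ x (n + 1)]
            simp [mul_comm, mul_left_comm]
          rw [e]
          refine hV.mul hS (hx.pow hS hx1 n).inv (by simpa using hpow (n + 1))
            (by simpa using hpow n) ?_
          rw [← e]
          simpa using hx1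
      rcases m with (_ | n) | n
      · exact hm rfl
      · exact key n b hb1 (by exact_mod_cast hV)
      · refine key n b⁻¹ (by simpa using hb1) ?_
        convert hV.inv using 1
        rw [zpow_negSucc, mul_inv]
        simp
    -- Not being alone in its coset, the point shares its basic set with `x ^ m * (1, b)⁻¹`;
    -- `exists_ne_of_exists_ne` then gives two points in the inverse coset as well, so all four
    -- candidates occur.
    have hnT : ¬ A.IsTransversal (x ^ m * (1, b)) := fun h =>
      hnV (h.isSymmPair hS hT (by simpa using hxm1))
    have hW := (isSSet_block (A := A) (x ^ m)).mul (isSSet_block (A := A) (1, b))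
    have hsub : ∀ u ∈ A.block (x ^ m * (1, b)), (u = x ^ m * (1, b) ∨ u = x ^ m * (1, b)⁻¹) ∨
            u = (x ^ m)⁻¹ * (1, b) ∨ u = (x ^ m)⁻¹ * (1, b)⁻¹ := by
      intro u hu
      obtain ⟨c, hc, d, hd, rfl⟩ :=
        hW _ (Set.mul_mem_mul (A.mem_block _) (A.mem_block _)) hu
      rw [hxm m] at hc
      rw [hT] at hd
      rcases hc with rfl | rfl <;> rcases hd with rfl | rfl <;> simp
    refine ⟨hsub u, ?_⟩
    have hne := Z.ne_inv hxm1
    have h1 : x ^ m * (1, b)⁻¹ ∈ A.block (x ^ m * (1, b)) := by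
      simp only [IsTransversal, not_forall] at hnT
      obtain ⟨y, hy, hyx, hyne⟩ := hnT
      rcases hsub y hy with (h | h) | h | h
      · exact absurd h hyne
      · rwa [← h]
      · rw [h] at hyx
        exact absurd (by simpa using hyx.symm) hne
      · rw [h] at hyx
        exact absurd (by simpa using hyx.symm) hne
    have hbne : x ^ m * (1, b)⁻¹ ≠ x ^ m * (1, b) := by
      intro h
      have h2 := congrArg Prod.snd (mul_left_cancel h)
      have key : ∀ b : Z3, b⁻¹ = b → b = 1 := by decide
      exact hb1 (key b h2)
    obtain ⟨v, hv, hv1⟩ := (hS (x ^ m * (1, b))).2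
    obtain ⟨v', hv', hvne, hv1'⟩ :=
      exists_ne_of_exists_ne h1 (A.mem_block _) hbne (by simp) hv
    have hcase : ∀ w ∈ A.block (x ^ m * (1, b)), w.1 = (x ^ m * (1, b)).1⁻¹ →
        w = (x ^ m)⁻¹ * (1, b) ∨ w = (x ^ m)⁻¹ * (1, b)⁻¹ := by
      intro w hw hw1
      rcases hsub w hw with (h | h) | h
      · rw [h] at hw1
        exact absurd (by simpa using hw1) hne
      · rw [h] at hw1
        exact absurd (by simpa using hw1) hne
      · exact h
    have h2 : (x ^ m)⁻¹ * (1, b) ∈ A.block (x ^ m * (1, b)) ∧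
        (x ^ m)⁻¹ * (1, b)⁻¹ ∈ A.block (x ^ m * (1, b)) := by
      rcases hcase v hv hv1 with h | h <;> rcases hcase v' hv' (hv1'.trans hv1) with h' | h'
      · exact absurd (h'.trans h.symm) hvne
      · exact ⟨h ▸ hv, h' ▸ hv'⟩
      · exact ⟨h' ▸ hv', h ▸ hv⟩
      · exact absurd (h'.trans h.symm) hvne
    rintro ((rfl | rfl) | rfl | rfl)
    · exact A.mem_block _
    · exact h1
    · exact h2.1
    · exact h2.2

end quotientSymmetric

end SchurRing

/-! ### Automorphisms in sheared coordinates -/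

/-- The automorphism of `Z × Z₃` inverting the second factor. -/
def invSnd : MulAut (Z × Z3) := MulEquiv.prodCongr (MulEquiv.refl Z) (MulEquiv.inv Z3)

/-- The automorphism of `Z × Z₃` inverting the first factor. -/
def invFst : MulAut (Z × Z3) := MulEquiv.prodCongr (MulEquiv.inv Z) (MulEquiv.refl Z3)

@[simp] theorem invSnd_apply (g : Z × Z3) : invSnd g = (g.1, g.2⁻¹) := rfl

@[simp] theorem invFst_apply (g : Z × Z3) : invFst g = (g.1⁻¹, g.2) := rfl

theorem MulAut.congr_apply_apply {G X : Type*} [Group G] [Group X] (e : G ≃* X) (σ : MulAut G)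
    (g : G) : MulAut.congr e σ (e g) = e (σ g) := by
  simp [MulAut.congr]

/-- The endomorphism of `Z × Z₃` with `z ↦ x` and `a ↦ a`. -/
def shear (x : Z × Z3) : Z × Z3 →* Z × Z3 :=
  (zpowersHom (Z × Z3) x).coprod (MonoidHom.inr Z Z3)

theorem shear_apply (x g : Z × Z3) : shear x g = x ^ Multiplicative.toAdd g.1 * (1, g.2) := rfl

theorem shear_injective {x : Z × Z3} (hx : x.1 ≠ 1) : Function.Injective (shear x) := by
  rw [injective_iff_map_eq_one]
  intro g hg
  rw [shear_apply] at hg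
  have h1 : x.1 ^ Multiplicative.toAdd g.1 = 1 := by simpa using congrArg Prod.fst hg
  have h2 : Multiplicative.toAdd g.1 = 0 := by
    by_contra hne
    exact hx ((IsMulTorsionFree.zpow_eq_one_iff_left hne).1 h1)
  rw [h2, zpow_zero, one_mul] at hg
  exact Prod.ext h2 (Prod.mk_eq_one.1 hg).2

theorem range_shear (x : Z × Z3) : (shear x).range = timesZ3 (Subgroup.zpowers x.1) := by
  ext g
  constructor
  · rintro ⟨u, rfl⟩
    exact ⟨⟨Multiplicative.toAdd u.1, by simp [shear_apply]⟩, Subgroup.mem_top _⟩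
  · rintro ⟨⟨m, hm⟩, -⟩
    refine ⟨(Multiplicative.ofAdd m, (x.2 ^ m)⁻¹ * g.2), ?_⟩
    ext
    · simpa [shear_apply] using congrArg Multiplicative.toAdd hm
    · simp [shear_apply]

/-- The isomorphism from `Z × Z₃` to `⟨h⟩ × Z₃` with `z ↦ (h, d)` and `a ↦ a`. -/
def shearEquiv {h : Z} (hh : h ≠ 1) (d : Z3) : Z × Z3 ≃* timesZ3 (Subgroup.zpowers h) :=
  (MonoidHom.ofInjective (shear_injective (x := (h, d)) hh)).trans
    (MulEquiv.subgroupCongr (range_shear (h, d)))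

theorem coe_shearEquiv {h : Z} (hh : h ≠ 1) (d : Z3) (g : Z × Z3) :
    (shearEquiv hh d g : Z × Z3) = shear (h, d) g := rfl

/-- The shear sends `z` to `(h, d)`, so the generator `(h, 1)` has sheared coordinates `(z, d⁻¹)`.
Inverting the second factor therefore sends it to `(h, d²) = (h, d⁻¹)`, while inverting the first
sends it to `(h⁻¹, d⁻²) = (h⁻¹, d)`: the same shear produces opposite twists. -/
theorem isAutWith_congr {h : Z} (hh : h ≠ 1) (d : Z3) (σ : MulAut (Z × Z3)) {x : Z × Z3} {y : Z3}
    (hx : shear (h, d) (σ (Multiplicative.ofAdd 1, d⁻¹)) = x)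
    (hy : shear (h, d) (σ (1, genA)) = (1, y)) :
    IsAutWith (Subgroup.zpowers h) (MulAut.congr (shearEquiv hh d) σ) h x y := by
  refine ⟨rfl, fun u hu => ?_, fun u hu => ?_⟩
  · have : u = shearEquiv hh d (Multiplicative.ofAdd 1, d⁻¹) := by
      apply Subtype.ext
      rw [hu, coe_shearEquiv, shear_apply]
      simp
    rw [this, MulAut.congr_apply_apply, coe_shearEquiv, hx]
  · have : u = shearEquiv hh d (1, genA) := by
      apply Subtype.ext
      rw [hu, coe_shearEquiv, shear_apply]
      simp
    rw [this, MulAut.congr_apply_apply, coe_shearEquiv, hy]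

theorem Z3.mul_self (b : Z3) : b * b = b⁻¹ := by
  revert b; decide

theorem genA_inv : genA⁻¹ = genA ^ 2 := by decide

theorem isAutWith_invSnd {h : Z} (hh : h ≠ 1) (d : Z3) :
    IsAutWith (Subgroup.zpowers h) (MulAut.congr (shearEquiv hh d) invSnd) h (h, d⁻¹)
      (genA ^ 2) := by
  apply isAutWith_congr
  · simp [shear_apply, Z3.mul_self]
  · simp [shear_apply, genA_inv]

theorem isAutWith_invFst {h : Z} (hh : h ≠ 1) (d : Z3) :
    IsAutWith (Subgroup.zpowers h) (MulAut.congr (shearEquiv hh d) invFst) h (h⁻¹, d) genA := by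
  apply isAutWith_congr
  · simp only [shear_apply, invFst_apply, toAdd_inv, toAdd_ofAdd, zpow_neg, zpow_one, Prod.inv_mk,
      Prod.mk_mul_mk, mul_one, ← mul_inv, Z3.mul_self, inv_inv]
  · simp [shear_apply]

theorem isAutWith_invSnd_mul_invFst {h : Z} (hh : h ≠ 1) (d : Z3) :
    IsAutWith (Subgroup.zpowers h) (MulAut.congr (shearEquiv hh d) (invSnd * invFst)) h (h⁻¹, 1)
      (genA ^ 2) := by
  apply isAutWith_congr
  · simp [shear_apply, MulAut.mul_apply]
  · simp [shear_apply, MulAut.mul_apply, genA_inv]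

/-! ### Recognising orbit Schur rings and wedge products -/

namespace SchurRing

variable {F : Type*} [Field F]

section orbit

variable {X : Type*} [Group X] {B : SchurRing F X} (e : Z × Z3 ≃* X)

theorem isOrbit_closure_image_congr {S : Set (MulAut (Z × Z3))}
    (h1 : ∀ σ ∈ S, ∀ g, e (σ g) ∈ B.block (e g))
    (h2 : ∀ g u, e u ∈ B.block (e g) → ∃ σ ∈ Subgroup.closure S, σ g = u) :
    B.IsOrbit (Subgroup.closure (MulAut.congr e '' S)) := by
  have : Group.FG X := Group.fg_of_surjective (f := e.toMonoidHom) e.surjective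
  refine isOrbit_closure ?_ ?_
  · rintro _ ⟨σ, hσ, rfl⟩ g
    obtain ⟨g, rfl⟩ := e.surjective g
    rw [MulAut.congr_apply_apply]
    exact h1 σ hσ g
  · intro g u hu
    obtain ⟨g, rfl⟩ := e.surjective g
    obtain ⟨u, rfl⟩ := e.surjective u
    obtain ⟨σ, hσ, rfl⟩ := h2 g u hu
    refine ⟨MulAut.congr e σ, ?_, MulAut.congr_apply_apply e σ g⟩
    have := MonoidHom.map_closure (MulAut.congr e).toMonoidHom S
    have h3 := Subgroup.mem_map_of_mem (MulAut.congr e).toMonoidHom hσ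
    rw [this] at h3
    exact h3

theorem isOrbit_closure_invSnd
    (h : ∀ g u, e u ∈ B.block (e g) ↔ u = g ∨ u = invSnd g) :
    B.IsOrbit (Subgroup.closure {MulAut.congr e invSnd}) := by
  rw [← Set.image_singleton]
  refine isOrbit_closure_image_congr e ?_ ?_
  · rintro _ rfl g
    exact (h _ _).2 (Or.inr rfl)
  · intro g u hu
    rcases (h _ _).1 hu with rfl | rfl
    · exact ⟨1, Subgroup.one_mem _, rfl⟩
    · exact ⟨invSnd, Subgroup.subset_closure rfl, rfl⟩

theorem isOrbit_closure_invFst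
    (h : ∀ g u, e u ∈ B.block (e g) ↔ u = g ∨ u = invFst g) :
    B.IsOrbit (Subgroup.closure {MulAut.congr e invFst}) := by
  rw [← Set.image_singleton]
  refine isOrbit_closure_image_congr e ?_ ?_
  · rintro _ rfl g
    exact (h _ _).2 (Or.inr rfl)
  · intro g u hu
    rcases (h _ _).1 hu with rfl | rfl
    · exact ⟨1, Subgroup.one_mem _, rfl⟩
    · exact ⟨invFst, Subgroup.subset_closure rfl, rfl⟩

theorem isOrbit_closure_invSnd_invFst
    (h : ∀ g u, e u ∈ B.block (e g) ↔
      (u = g ∨ u = invSnd g) ∨ u = invFst g ∨ u = (invSnd * invFst) g) :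
    B.IsOrbit (Subgroup.closure {MulAut.congr e invSnd, MulAut.congr e invFst}) := by
  rw [← Set.image_pair]
  refine isOrbit_closure_image_congr e ?_ ?_
  · rintro _ (rfl | rfl) g
    · exact (h _ _).2 (Or.inl (Or.inr rfl))
    · exact (h _ _).2 (Or.inr (Or.inl rfl))
  · have h1 : invSnd ∈ Subgroup.closure {invSnd, invFst} := Subgroup.subset_closure (Or.inl rfl)
    have h2 : invFst ∈ Subgroup.closure {invSnd, invFst} := Subgroup.subset_closure (Or.inr rfl)
    intro g u hu
    rcases (h _ _).1 hu with (rfl | rfl) | rfl | rfl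
    · exact ⟨1, Subgroup.one_mem _, rfl⟩
    · exact ⟨_, h1, rfl⟩
    · exact ⟨_, h2, rfl⟩
    · exact ⟨_, Subgroup.mul_mem _ h1 h2, rfl⟩

/-- The group of order four is the same as with both partial inversions; the generating set is the
one matching `ψ` and `ξ`, where `ξ` is inversion of the whole group. -/
theorem isOrbit_closure_invSnd_mul
    (h : ∀ g u, e u ∈ B.block (e g) ↔
      (u = g ∨ u = invSnd g) ∨ u = invFst g ∨ u = (invSnd * invFst) g) :
    B.IsOrbit (Subgroup.closure {MulAut.congr e invSnd, MulAut.congr e (invSnd * invFst)}) := by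
  rw [← Set.image_pair]
  refine isOrbit_closure_image_congr e ?_ ?_
  · rintro _ (rfl | rfl) g
    · exact (h _ _).2 (Or.inl (Or.inr rfl))
    · exact (h _ _).2 (Or.inr (Or.inr rfl))
  · have h1 : invSnd ∈ Subgroup.closure {invSnd, invSnd * invFst} :=
      Subgroup.subset_closure (Or.inl rfl)
    have h2 : invSnd * invFst ∈ Subgroup.closure {invSnd, invSnd * invFst} :=
      Subgroup.subset_closure (Or.inr rfl)
    intro g u hu
    rcases (h _ _).1 hu with (rfl | rfl) | rfl | rfl
    · exact ⟨1, Subgroup.one_mem _, rfl⟩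
    · exact ⟨_, h1, rfl⟩
    · exact ⟨invSnd⁻¹ * (invSnd * invFst),
        Subgroup.mul_mem _ (Subgroup.inv_mem _ h1) h2, by rw [inv_mul_cancel_left]⟩
    · exact ⟨_, h2, rfl⟩

end orbit

section wedge

theorem isSSet_timesZ3 {A : SchurRing F (Z × Z3)}
    (hA : ∀ g, ∀ u ∈ A.block g, u.1 = g.1 ∨ u.1 = g.1⁻¹) (H : Subgroup Z) :
    A.IsSSet (timesZ3 H : Set (Z × Z3)) := by
  rintro g ⟨hg, -⟩ u hu
  refine ⟨?_, Subgroup.mem_top _⟩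
  rcases hA g u hu with h | h
  · change u.1 ∈ H
    rw [h]; exact hg
  · change u.1 ∈ H
    rw [h]; exact H.inv_mem hg

/-- The Schur ring over an `S`-subgroup `H` whose basic sets are those of `A` inside `H`. -/
def restrict {G : Type*} [Group G] (A : SchurRing F G) (H : Subgroup G)
    (hH : A.IsSSet (H : Set G)) : SchurRing F H :=
  A.comap H.subtype H.subtype_injective (by
    rw [← MonoidHom.coe_range, Subgroup.range_subtype]; exact hH)

theorem mem_block_restrict {G : Type*} [Group G] {A : SchurRing F G} {H : Subgroup G}
    (hH : A.IsSSet (H : Set G)) {g u : H} :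
    u ∈ (A.restrict H hH).block g ↔ (u : G) ∈ A.block (g : G) :=
  mem_block_comap _ _

variable [CharZero F]

theorem ker_mk_subZ3 : ((QuotientGroup.mk' subZ3).ker : Set (Z × Z3)) = {g | g.1 = 1} := by
  rw [QuotientGroup.ker_mk']
  ext g
  simp [Subgroup.mem_prod]

/-- The quotient of a Schur ring over `Z × Z₃` by `Z₃`. -/
def quotientZ3 (A : SchurRing F (Z × Z3)) : SchurRing F ((Z × Z3) ⧸ subZ3) :=
  A.map (QuotientGroup.mk' subZ3) (QuotientGroup.mk'_surjective _)
    (by rw [ker_mk_subZ3]; exact isSSet_fst_eq_one) (by rw [ker_mk_subZ3]; exact finite_fst_eq 1)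

variable {A : SchurRing F (Z × Z3)}

theorem block_quotientZ3 (g : Z × Z3) :
    A.quotientZ3.block (g : (Z × Z3) ⧸ subZ3) = QuotientGroup.mk '' A.block g :=
  block_map _ _ _ g

theorem mk_subZ3_eq_iff {g h : Z × Z3} :
    (g : (Z × Z3) ⧸ subZ3) = (h : (Z × Z3) ⧸ subZ3) ↔ g.1 = h.1 := by
  rw [QuotientGroup.eq]
  simp [Subgroup.mem_prod, inv_mul_eq_one]

theorem isDiscrete_quotientZ3 (hD : ∀ g, ∀ u ∈ A.block g, u.1 = g.1) :
    A.quotientZ3.IsDiscrete := by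
  apply isDiscrete_of_block
  intro g
  obtain ⟨g, rfl⟩ := QuotientGroup.mk_surjective g
  rw [block_quotientZ3]
  rintro _ ⟨u, hu, rfl⟩
  exact mk_subZ3_eq_iff.2 (hD g u hu)

theorem isSymmetric_quotientZ3
    (hS : ∀ g, (∀ u ∈ A.block g, u.1 = g.1 ∨ u.1 = g.1⁻¹) ∧ ∃ u ∈ A.block g, u.1 = g.1⁻¹) :
    A.quotientZ3.IsSymmetric := by
  apply isSymmetric_of_block
  intro g u
  obtain ⟨g, rfl⟩ := QuotientGroup.mk_surjective g
  constructor
  · intro hu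
    obtain ⟨v, hv, rfl⟩ := (block_quotientZ3 g).subset hu
    rw [← QuotientGroup.mk_inv, mk_subZ3_eq_iff, mk_subZ3_eq_iff]
    exact (hS g).1 v hv
  · rintro (rfl | rfl)
    · exact mem_block _ _
    · obtain ⟨v, hv, hv1⟩ := (hS g).2
      refine (block_quotientZ3 g).symm.subset ⟨v, hv, ?_⟩
      rw [← QuotientGroup.mk_inv, mk_subZ3_eq_iff]
      exact hv1

/-- A basic set that contains the whole coset of each of its points is a union of cosets, and `hA`
makes `H × Z₃` an `S`-subgroup for every `H`. -/
theorem isWedge_of_full (hA : ∀ g, ∀ u ∈ A.block g, u.1 = g.1 ∨ u.1 = g.1⁻¹) {H : Subgroup Z}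
    (hH : H ≠ ⊤) (hfull : ∀ g : Z × Z3, g.1 ∉ H → ∀ u : Z × Z3, u.1 = g.1 → u ∈ A.block g) :
    A.IsWedge subZ3 (timesZ3 H) (A.restrict (timesZ3 H) (isSSet_timesZ3 hA H)) A.quotientZ3 := by
  refine ⟨⟨?_, ?_, ?_, inferInstance, (isSSet_timesZ3 hA ⊥).isSSubgroup,
    (isSSet_timesZ3 hA H).isSSubgroup, ?_⟩, fun C => mem_comap_D _ _, rfl⟩
  · intro h
    have : ((1 : Z), genA) ∈ subZ3 := ⟨Subgroup.one_mem _, Subgroup.mem_top _⟩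
    rw [h, Subgroup.mem_bot] at this
    exact absurd (congrArg Prod.snd this) (by decide)
  · exact Subgroup.prod_mono bot_le le_rfl
  · intro h
    apply hH
    rw [eq_top_iff]
    intro n _
    have : ((n, 1) : Z × Z3) ∈ timesZ3 H := by rw [h]; exact Subgroup.mem_top _
    exact this.1
  · intro C hC hdisj
    refine Set.Subset.antisymm ?_ fun c hc => ⟨c, hc, 1, Subgroup.one_mem _, mul_one c⟩
    rintro _ ⟨c, hc, k, ⟨hk, -⟩, rfl⟩
    have hcH : c.1 ∉ H := fun h =>
      Set.disjoint_left.1 hdisj hc ⟨h, Subgroup.mem_top _⟩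
    rw [eq_block hC hc]
    have hk1 : k.1 = 1 := hk
    exact hfull c hcH _ (by simp [hk1])

end wedge

end SchurRing

theorem shear_invSnd (x g : Z × Z3) :
    shear x (invSnd g) = x ^ Multiplicative.toAdd g.1 * (1, g.2)⁻¹ := by
  simp [shear_apply]

theorem shear_invFst (x g : Z × Z3) :
    shear x (invFst g) = (x ^ Multiplicative.toAdd g.1)⁻¹ * (1, g.2) := by
  simp [shear_apply]

theorem shear_invSnd_mul_invFst (x g : Z × Z3) :
    shear x ((invSnd * invFst) g) = (x ^ Multiplicative.toAdd g.1)⁻¹ * (1, g.2)⁻¹ := by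
  simp [shear_apply, MulAut.mul_apply]

/-- The automorphism of `Z × Z₃` with `z ↦ (h, d)` and `a ↦ a`, for a generator `h` of `Z`. -/
def shearAut {h : Z} (hh : h ≠ 1) (htop : Subgroup.zpowers h = ⊤) (d : Z3) :
    Z × Z3 ≃* Z × Z3 :=
  MulEquiv.ofBijective (shear (h, d)) ⟨shear_injective hh, by
    rw [← MonoidHom.range_eq_top, range_shear]
    simp [htop]⟩

namespace SchurRing

variable {F : Type*} [Field F]

theorem isDiscrete_of_equiv {X : Type*} [Group X] {B : SchurRing F X} (e : Z × Z3 ≃* X)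
    (h : ∀ g u, e u ∈ B.block (e g) ↔ u = g) : B.IsDiscrete := by
  apply isDiscrete_of_block
  intro g u hu
  obtain ⟨g, rfl⟩ := e.surjective g
  obtain ⟨u, rfl⟩ := e.surjective u
  rw [(h g u).1 hu]

theorem isSymmetric_of_equiv {X : Type*} [CommGroup X] {B : SchurRing F X} (e : Z × Z3 ≃* X)
    (h : ∀ g u, e u ∈ B.block (e g) ↔ u = g ∨ u = g⁻¹) : B.IsSymmetric := by
  apply isSymmetric_of_block
  intro g u
  obtain ⟨g, rfl⟩ := e.surjective g
  obtain ⟨u, rfl⟩ := e.surjective u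
  rw [h, ← map_inv, e.injective.eq_iff, e.injective.eq_iff]

theorem shear_mem_block_cases_of_quotient_discrete {A : SchurRing F (Z × Z3)} {x : Z × Z3}
    (hx : x.1 ≠ 1)
    (h : (∀ (m : ℤ) (b : Z3) (u : Z × Z3),
          u ∈ A.block (x ^ m * (1, b)) ↔ u = x ^ m * (1, b)) ∨
        ∀ (m : ℤ) (b : Z3) (u : Z × Z3), u ∈ A.block (x ^ m * (1, b)) ↔
          u = x ^ m * (1, b) ∨ u = x ^ m * (1, b)⁻¹) :
    (∀ g u, shear x u ∈ A.block (shear x g) ↔ u = g) ∨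
      ∀ g u, shear x u ∈ A.block (shear x g) ↔ u = g ∨ u = invSnd g := by
  refine h.imp (fun h g u => ?_) fun h g u => ?_ <;>
  · have := h (Multiplicative.toAdd g.1) g.2 (shear x u)
    simpa only [← shear_invSnd, ← shear_apply, (shear_injective hx).eq_iff] using this

theorem shear_mem_block_cases_of_quotient_symmetric {A : SchurRing F (Z × Z3)} {x : Z × Z3}
    (hx : x.1 ≠ 1)
    (h : (∀ (m : ℤ) (b : Z3) (u : Z × Z3), u ∈ A.block (x ^ m * (1, b)) ↔
          u = x ^ m * (1, b) ∨ u = (x ^ m)⁻¹ * (1, b)) ∨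
        (∀ (m : ℤ) (b : Z3) (u : Z × Z3), u ∈ A.block (x ^ m * (1, b)) ↔
          (u = x ^ m * (1, b) ∨ u = x ^ m * (1, b)⁻¹) ∨
            u = (x ^ m)⁻¹ * (1, b) ∨ u = (x ^ m)⁻¹ * (1, b)⁻¹) ∨
        ∀ (m : ℤ) (b : Z3) (u : Z × Z3), u ∈ A.block (x ^ m * (1, b)) ↔
          u = x ^ m * (1, b) ∨ u = (x ^ m * (1, b))⁻¹) :
    (∀ g u, shear x u ∈ A.block (shear x g) ↔ u = g ∨ u = invFst g) ∨
      (∀ g u, shear x u ∈ A.block (shear x g) ↔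
        (u = g ∨ u = invSnd g) ∨ u = invFst g ∨ u = (invSnd * invFst) g) ∨
      ∀ g u, shear x u ∈ A.block (shear x g) ↔ u = g ∨ u = g⁻¹ := by
  refine h.imp (fun h g u => ?_) (Or.imp (fun h g u => ?_) fun h g u => ?_) <;>
  · have := h (Multiplicative.toAdd g.1) g.2 (shear x u)
    simpa only [← shear_invSnd, ← shear_invFst, ← shear_invSnd_mul_invFst, ← shear_apply,
      ← map_inv, (shear_injective hx).eq_iff] using this

theorem shearEquiv_mem_block_restrict {A : SchurRing F (Z × Z3)} {h : Z} (hh : h ≠ 1) {d : Z3}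
    (hS : A.IsSSet (timesZ3 (Subgroup.zpowers h) : Set (Z × Z3))) (g u : Z × Z3) :
    shearEquiv hh d u ∈ (A.restrict _ hS).block (shearEquiv hh d g) ↔
      shear (h, d) u ∈ A.block (shear (h, d) g) :=
  mem_block_restrict hS

variable [CharZero F]

theorem restrict_subZ3_cases {A : SchurRing F (Z × Z3)} (hS : A.IsSSet (subZ3 : Set (Z × Z3))) :
    (A.restrict subZ3 hS).IsDiscrete ∨ (A.restrict subZ3 hS).IsSymmetric := by
  have hcoe : ∀ g : subZ3, (g : Z × Z3) = (1, (g : Z × Z3).2) := fun g => Prod.ext g.2.1 rfl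
  rcases torsion_cases (A := A) with hT | hT
  · left
    apply isDiscrete_of_block
    intro g u hu
    rw [mem_block_restrict, hcoe g, mem_thin.1 (hT _), ← hcoe g] at hu
    exact Subtype.ext hu
  · right
    apply isSymmetric_of_block
    intro g u
    rw [mem_block_restrict, hcoe g, hT, ← hcoe g, ← Subgroup.coe_inv, Subtype.coe_inj,
      Subtype.coe_inj]

end SchurRing

/-! ### Assembling the classification -/

open SchurRing in
theorem schurRing_classification (F : Type*) [Field F] [CharZero F] (A : SchurRing F (Z × Z3)) :
      (∃ (A₁ : SchurRing F subZ3) (A₂ : SchurRing F ((Z × Z3) ⧸ subZ3)),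
        A.IsWedge subZ3 subZ3 A₁ A₂ ∧
          (A₁.IsDiscrete ∨ A₁.IsSymmetric) ∧ (A₂.IsDiscrete ∨ A₂.IsSymmetric)) ∨
      (∃ H : Subgroup Z, H ≠ ⊥ ∧ H ≠ ⊤ ∧
        ∃ (h : Z) (α β : MulAut (timesZ3 H)),
          IsAutWith H α h (h, 1) (genA ^ 2) ∧ IsAutWith H β h (h⁻¹, 1) genA ∧
          ∃ (A₁ : SchurRing F (timesZ3 H)) (A₂ : SchurRing F ((Z × Z3) ⧸ subZ3)),
            A.IsWedge subZ3 (timesZ3 H) A₁ A₂ ∧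
            ((A₂.IsDiscrete ∧ (A₁.IsDiscrete ∨ A₁.IsOrbit (Subgroup.closure {α}))) ∨
             (A₂.IsSymmetric ∧ (A₁.IsSymmetric ∨ A₁.IsOrbit (Subgroup.closure {β}) ∨
                A₁.IsOrbit (Subgroup.closure {α, β}))))) ∨
      (∃ K : Subgroup Z, K ≠ ⊥ ∧ K ≠ ⊤ ∧
        ∃ (k : Z) (c : Z3) (ψ ρ ξ : MulAut (timesZ3 K)),
          (c = genA ∨ c = genA ^ 2) ∧ IsAutWith K ψ k (k, c) (genA ^ 2) ∧
          IsAutWith K ρ k (k⁻¹, c) genA ∧ IsAutWith K ξ k (k⁻¹, 1) (genA ^ 2) ∧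
          ∃ (A₁ : SchurRing F (timesZ3 K)) (A₂ : SchurRing F ((Z × Z3) ⧸ subZ3)),
            A.IsWedge subZ3 (timesZ3 K) A₁ A₂ ∧
            ((A₂.IsDiscrete ∧ A₁.IsOrbit (Subgroup.closure {ψ})) ∨
             (A₂.IsSymmetric ∧ (A₁.IsOrbit (Subgroup.closure {ρ}) ∨
                A₁.IsOrbit (Subgroup.closure {ψ, ξ}))))) ∨
      (A.IsDiscrete ∨ A.IsSymmetric) ∨
      A.IsOrbitSchurRing := by
  have hA : ∀ g, ∀ u ∈ A.block g, u.1 = g.1 ∨ u.1 = g.1⁻¹ := by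
    rcases quotient_cases A with hD | hS
    · exact fun g u hu => Or.inl (hD g u hu)
    · exact fun g u hu => (hS g).1 u hu
  have hbot : ∀ x : Z × Z3, A.IsFullOutside x → x.1 = 1 →
      A.IsWedge subZ3 subZ3 (A.restrict subZ3 (isSSet_timesZ3 hA ⊥)) A.quotientZ3 := by
    intro x hx hx1
    refine isWedge_of_full hA bot_ne_top fun g hg => hx g ?_
    rwa [hx1, Subgroup.zpowers_one_eq_bot]
  have hne : ∀ {h : Z}, h ≠ 1 → Subgroup.zpowers h ≠ ⊥ := fun hh =>
    mt Subgroup.zpowers_eq_bot.1 hh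
  have hc : ∀ {d : Z3}, d ≠ 1 → d = genA ∨ d = genA ^ 2 := fun hd =>
    (Z3.eq_one_or _).resolve_left hd
  -- The shear by `d⁻¹` is used so that `ψ` carries the twist `d`, as `ρ` does for the shear by `d`.
  have hψ : ∀ {h : Z} (hh : h ≠ 1) (d : Z3), IsAutWith (Subgroup.zpowers h)
      (MulAut.congr (shearEquiv hh d⁻¹) invSnd) h (h, d) (genA ^ 2) := fun hh d => by
    simpa using isAutWith_invSnd hh d⁻¹
  have hα : ∀ {h : Z} (hh : h ≠ 1), IsAutWith (Subgroup.zpowers h)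
      (MulAut.congr (shearEquiv hh 1) invSnd) h (h, 1) (genA ^ 2) := fun hh => by
    simpa using isAutWith_invSnd hh 1
  rcases quotient_cases A with hD | hS
  · obtain ⟨⟨h, d⟩, hfull, hst⟩ := structure_of_quotient_discrete hD
    have hQ := isDiscrete_quotientZ3 hD
    by_cases hh : h = 1
    · exact Or.inl ⟨_, _, hbot _ hfull hh, restrict_subZ3_cases _, Or.inl hQ⟩
    have hst' := shear_mem_block_cases_of_quotient_discrete (x := (h, d)) hh hst
    by_cases htop : Subgroup.zpowers h = ⊤
    · right; right; right
      rcases hst' with hb | hb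
      · exact Or.inl (Or.inl (isDiscrete_of_equiv (shearAut hh htop d) hb))
      · exact Or.inr ⟨_, isOrbit_closure_invSnd (shearAut hh htop d) hb⟩
    have hW := isWedge_of_full hA htop hfull
    have hr := shearEquiv_mem_block_restrict (A := A) hh (d := d) (isSSet_timesZ3 hA _)
    rcases hst' with hb | hb
    · refine Or.inr (Or.inl ⟨_, hne hh, htop, h, _, _, hα hh, isAutWith_invFst hh 1, _, _, hW,
        Or.inl ⟨hQ, Or.inl (isDiscrete_of_equiv (shearEquiv hh d) fun g u => ?_)⟩⟩)
      rw [hr, hb]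
    · have ho := isOrbit_closure_invSnd (shearEquiv hh d) fun g u => (hr g u).trans (hb g u)
      by_cases hd : d = 1
      · subst hd
        exact Or.inr (Or.inl ⟨_, hne hh, htop, h, _, _, hα hh,
          isAutWith_invFst hh 1, _, _, hW, Or.inl ⟨hQ, Or.inr ho⟩⟩)
      -- The twist is `c = d⁻¹`, dictated by `ψ`; `ρ` only has to exist with the same `c` and comes
      -- from the shear by `d⁻¹`.
      · exact Or.inr (Or.inr (Or.inl ⟨_, hne hh, htop, h, d⁻¹, _, _, _,
          hc (inv_ne_one.2 hd), isAutWith_invSnd hh d, isAutWith_invFst hh d⁻¹,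
          isAutWith_invSnd_mul_invFst hh d, _, _, hW, Or.inl ⟨hQ, ho⟩⟩))
  · obtain ⟨⟨h, d⟩, hfull, hst⟩ := structure_of_quotient_symmetric hS
    have hQ := isSymmetric_quotientZ3 hS
    by_cases hh : h = 1
    · exact Or.inl ⟨_, _, hbot _ hfull hh, restrict_subZ3_cases _, Or.inr hQ⟩
    have hst' := shear_mem_block_cases_of_quotient_symmetric (x := (h, d)) hh hst
    by_cases htop : Subgroup.zpowers h = ⊤
    · right; right; right
      rcases hst' with hb | hb | hb
      · exact Or.inr ⟨_, isOrbit_closure_invFst (shearAut hh htop d) hb⟩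
      · exact Or.inr ⟨_, isOrbit_closure_invSnd_invFst (shearAut hh htop d) hb⟩
      · exact Or.inl (Or.inr (isSymmetric_of_equiv (shearAut hh htop d) hb))
    have hW := isWedge_of_full hA htop hfull
    have hr := shearEquiv_mem_block_restrict (A := A) hh (d := d) (isSSet_timesZ3 hA _)
    rcases hst' with hb | hb | hb
    · have ho := isOrbit_closure_invFst (shearEquiv hh d) fun g u => (hr g u).trans (hb g u)
      by_cases hd : d = 1
      · subst hd
        exact Or.inr (Or.inl ⟨_, hne hh, htop, h, _, _, hα hh,
          isAutWith_invFst hh 1, _, _, hW, Or.inr ⟨hQ, Or.inr (Or.inl ho)⟩⟩)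
      · exact Or.inr (Or.inr (Or.inl ⟨_, hne hh, htop, h, d, _, _, _,
          hc hd, hψ hh d, isAutWith_invFst hh d,
          isAutWith_invSnd_mul_invFst hh d, _, _, hW, Or.inr ⟨hQ, Or.inl ho⟩⟩))
    · by_cases hd : d = 1
      · subst hd
        exact Or.inr (Or.inl ⟨_, hne hh, htop, h, _, _, hα hh,
          isAutWith_invFst hh 1, _, _, hW, Or.inr ⟨hQ, Or.inr (Or.inr
            (isOrbit_closure_invSnd_invFst (shearEquiv hh 1)
              fun g u => (hr g u).trans (hb g u)))⟩⟩)
      · exact Or.inr (Or.inr (Or.inl ⟨_, hne hh, htop, h, d⁻¹, _, _, _,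
          hc (inv_ne_one.2 hd), isAutWith_invSnd hh d, isAutWith_invFst hh d⁻¹,
          isAutWith_invSnd_mul_invFst hh d, _, _, hW, Or.inr ⟨hQ, Or.inr
            (isOrbit_closure_invSnd_mul (shearEquiv hh d)
              fun g u => (hr g u).trans (hb g u))⟩⟩))
    -- Full inversion commutes with every isomorphism, so `d` plays no role.
    · exact Or.inr (Or.inl ⟨_, hne hh, htop, h, _, _, hα hh,
        isAutWith_invFst hh 1, _, _, hW, Or.inr ⟨hQ, Or.inl
          (isSymmetric_of_equiv (shearEquiv hh d) fun g u => (hr g u).trans (hb g u))⟩⟩)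

end

theorem theorem1p1 (F : Type*) [Field F] [CharZero F] :
    (∀ A : SchurRing F (Z × Z3),
      -- (i) wedge products of a Schur ring over `Z₃` with one over `Z = (Z × Z₃) / Z₃`
      (∃ (A₁ : SchurRing F subZ3) (A₂ : SchurRing F ((Z × Z3) ⧸ subZ3)),
        A.IsWedge subZ3 subZ3 A₁ A₂ ∧
          (A₁.IsDiscrete ∨ A₁.IsSymmetric) ∧ (A₂.IsDiscrete ∨ A₂.IsSymmetric)) ∨
      -- (ii) wedge products over `H × Z₃`
      (∃ H : Subgroup Z, H ≠ ⊥ ∧ H ≠ ⊤ ∧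
        ∃ (h : Z) (α β : MulAut (timesZ3 H)),
          IsAutWith H α h (h, 1) (genA ^ 2) ∧ IsAutWith H β h (h⁻¹, 1) genA ∧
          ∃ (A₁ : SchurRing F (timesZ3 H)) (A₂ : SchurRing F ((Z × Z3) ⧸ subZ3)),
            A.IsWedge subZ3 (timesZ3 H) A₁ A₂ ∧
            ((A₂.IsDiscrete ∧ (A₁.IsDiscrete ∨ A₁.IsOrbit (Subgroup.closure {α}))) ∨
             (A₂.IsSymmetric ∧ (A₁.IsSymmetric ∨ A₁.IsOrbit (Subgroup.closure {β}) ∨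
                A₁.IsOrbit (Subgroup.closure {α, β}))))) ∨
      -- (iii) wedge products over `K × Z₃`
      (∃ K : Subgroup Z, K ≠ ⊥ ∧ K ≠ ⊤ ∧
        ∃ (k : Z) (c : Z3) (ψ ρ ξ : MulAut (timesZ3 K)),
          (c = genA ∨ c = genA ^ 2) ∧ IsAutWith K ψ k (k, c) (genA ^ 2) ∧
          IsAutWith K ρ k (k⁻¹, c) genA ∧ IsAutWith K ξ k (k⁻¹, 1) (genA ^ 2) ∧
          ∃ (A₁ : SchurRing F (timesZ3 K)) (A₂ : SchurRing F ((Z × Z3) ⧸ subZ3)),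
            A.IsWedge subZ3 (timesZ3 K) A₁ A₂ ∧
            ((A₂.IsDiscrete ∧ A₁.IsOrbit (Subgroup.closure {ψ})) ∨
             (A₂.IsSymmetric ∧ (A₁.IsOrbit (Subgroup.closure {ρ}) ∨
                A₁.IsOrbit (Subgroup.closure {ψ, ξ}))))) ∨
      -- (iv) the group ring and the symmetric Schur ring
      (A.IsDiscrete ∨ A.IsSymmetric) ∨
      -- (v) the orbit Schur rings
      A.IsOrbitSchurRing) ∧
    (∀ A : SchurRing F (Z × Z3), A.IsOrbitSchurRing ∨ A.IsWedgeProduct) ∧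
    IsTraditionalGroup F (Z × Z3) := by
  have key : ∀ A : SchurRing F (Z × Z3), A.IsOrbitSchurRing ∨ A.IsWedgeProduct := by
    intro A
    rcases schurRing_classification F A with ⟨_, _, hW, -⟩ |
      ⟨H, -, -, _, _, _, -, -, _, _, hW, -⟩ | ⟨K, -, -, _, _, _, _, _, -, -, -, -, _, _, hW, -⟩ |
      (h | h) | h
    · exact Or.inr ⟨_, _, hW.1⟩
    · exact Or.inr ⟨_, _, hW.1⟩
    · exact Or.inr ⟨_, _, hW.1⟩
    · exact Or.inl h.isOrbitSchurRing
    · exact Or.inl ⟨_, h⟩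
    · exact Or.inl h
  refine ⟨schurRing_classification F, key, fun A => ?_⟩
  rcases key A with h | h
  · exact Or.inr (Or.inl h)
  · exact Or.inr (Or.inr (Or.inr h))
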